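/- Let $\mathcal A$ be a weakly idempotent complete exact category, i.e. an additive category with a class of kernel–cokernel pairs (conflations, consisting of an inflation followed by a deflation) satisfying Quillen's axioms, in which every split epimorphism has a kernel. Let $\mathcal X$ and $\mathcal Y$ be full additive subcategories of $\mathcal A$ closed under isomorphisms and direct summands, and put $\omega=\mathcal X\cap\mathcal Y$. Define three classes of morphisms of $\mathcal A$: - $\mathrm{CoFib}_\omega$ is the class of inflations with cokernel in $\mathcal X$; - $\mathrm{Fib}_\omega$ is the class of morphisms $f:A\to B$ such that $\mathrm{Hom}_{\mathcal A}(W,f)$ is surjective for every $W\in\omega$; - $\mathrm{Weq}_\omega$ is the class of morphisms $f:A\to B$ for which there are $W\in\omega$ and $t:W\to B$ such that $(f,t):A\oplus W\to B$ is a deflation with kernel in $\mathcal Y$. A *model structure* is a triple of classes of morphisms (cofibrations, fibrations, weak equivalences) satisfying the two out of three axiom for weak equivalences, the retract axiom for all three classes, the lifting axiom and the factorization axiom (no existence of limits or colimits is required). An object $Z$ is *cofibrant* if $0\to Z$ is a cofibration, *fibrant* if $Z\to 0$ is a fibration, *trivial* if $0\to Z$ is a weak equivalence. A fibration or cofibration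 is *trivial* if it is a weak equivalence. The pair $(\mathcal X,\mathcal Y)$ is a *cotorsion pair* if $\mathcal X=\{A\mid \mathrm{Ext}^1_{\mathcal A}(A,Y)=0\ \forall\, Y\in\mathcal Y\}$ and $\mathcal Y=\{A\mid \mathrm{Ext}^1_{\mathcal A}(X,A)=0\ \forall\, X\in\mathcal X\}$; it is *complete* if every object $A$ admits conflations $Y\to X\to A$ and $A\to Y'\to X'$ with $X,X'\in\mathcal X$ and $Y,Y'\in\mathcal Y$; it is *hereditary* if $\mathcal X$ is closed under kernels of deflations and $\mathcal Y$ is closed under cokernels of inflations. The subcategory $\omega$ is *contravariantly finite* if for every object $B$ there is a morphism $W\to B$ with $W\in\omega$ through which every morphism from an object of $\omega$ to $B$ factors. **Theorem.** $(\mathrm{CoFib}_\omega,\mathrm{Fib}_\omega,\mathrm{Weq}_\omega)$ is a model structure on $\mathcal A$ if and only if $(\mathcal X,\mathcal Y)$ is a hereditary complete cotorsion pair in $\mathcal A$ and $\omega$ is contravariantly finite in $\mathcal A$. If this is the case, then the class of trivial cofibrations is precisely the class of split monomorphisms with cokernel in $\omega$, and the class of trivial fibrations is precisely the class of deflations with kernel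 in $\mathcal Y$; the class of cofibrant objects is $\mathcal X$, every object of $\mathcal A$ is fibrant, and the class of trivial objects is $\mathcal Y$. Moreover, the composite $\mathcal X\hookrightarrow\mathcal A\to \mathrm{Ho}(\mathcal A)=\mathcal A[\mathrm{Weq}_\omega^{-1}]$ of the inclusion and the localization functor induces, up to natural isomorphism, an equivalence of categories $\mathcal X/\omega\simeq\mathrm{Ho}(\mathcal A)$, where the additive quotient $\mathcal X/\omega$ has the objects of $\mathcal X$ and the morphism groups $\mathrm{Hom}_{\mathcal A}(X,X')/\{f\mid f\text{ factors through an object of }\omega\}$. -/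

import Mathlib

universe v u

open CategoryTheory CategoryTheory.Limits
open scoped ZeroObject

namespace OmegaModel

/-! ### Exact categories

Composition is written in diagrammatic order: `f ≫ g` is `g ∘ f`. -/

/-- `i` is the first map of a pair in the class `S`. -/
def IsInflation {A : Type u} [Category.{v} A] [HasZeroMorphisms A]
    (S : ObjectProperty (ShortComplex A)) {X Y : A} (i : X ⟶ Y) : Prop :=
  ∃ (C : A) (c : Y ⟶ C) (w : i ≫ c = 0), S (ShortComplex.mk i c w)

/-- `d` is the second map of a pair in the class `S`. -/
def IsDeflation {A : Type u} [Category.{v} A] [HasZeroMorphisms A]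
    (S : ObjectProperty (ShortComplex A)) {X Y : A} (d : X ⟶ Y) : Prop :=
  ∃ (K : A) (k : K ⟶ X) (w : k ≫ d = 0), S (ShortComplex.mk k d w)

/-- An exact structure (in the sense of Quillen, with Keller's axioms) on an additive category:
a class of kernel-cokernel pairs, called conflations. -/
structure ExactStructure (A : Type u) [Category.{v} A] [Preadditive A] [HasZeroObject A]
    [HasBinaryBiproducts A] where
  /-- the class of conflations, as a class of composable pairs `X₁ ⟶ X₂ ⟶ X₃` with zero composite -/
  conflation : ObjectProperty (ShortComplex A)
  /-- in a conflation, the first map is a kernel of the second one -/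
  isKernel (S : ShortComplex A) (hS : conflation S) :
    Nonempty (IsLimit (KernelFork.ofι S.f S.zero))
  /-- in a conflation, the second map is a cokernel of the first one -/
  isCokernel (S : ShortComplex A) (hS : conflation S) :
    Nonempty (IsColimit (CokernelCofork.ofπ S.g S.zero))
  /-- (E0), closure under isomorphisms -/
  of_iso (S T : ShortComplex A) (e : S ≅ T) (hS : conflation S) : conflation T
  /-- (E0), the identity of the zero object is a deflation -/
  id_zero : IsDeflation conflation (𝟙 (0 : A))
  /-- (E1), the composition of two deflations is a deflation -/
  comp {X Y Z : A} (d : X ⟶ Y) (e : Y ⟶ Z) (hd : IsDeflation conflation d)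
    (he : IsDeflation conflation e) : IsDeflation conflation (d ≫ e)
  /-- (E2), pullbacks of deflations exist and are deflations -/
  pullback {Y Z Z' : A} (d : Y ⟶ Z) (f : Z' ⟶ Z) (hd : IsDeflation conflation d) :
    ∃ (Y' : A) (f' : Y' ⟶ Y) (d' : Y' ⟶ Z'), IsPullback f' d' d f ∧ IsDeflation conflation d'
  /-- (E2ᵒᵖ), pushouts of inflations exist and are inflations -/
  pushout {X Y X' : A} (i : X ⟶ Y) (f : X ⟶ X') (hi : IsInflation conflation i) :
    ∃ (Y' : A) (f' : Y ⟶ Y') (i' : X' ⟶ Y'), IsPushout i f f' i' ∧ IsInflation conflation i'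

/-- Weak idempotent completeness: every split epimorphism has a kernel. -/
def WeaklyIdempotentComplete (A : Type u) [Category.{v} A] [Preadditive A] : Prop :=
  ∀ ⦃X Y : A⦄ (f : X ⟶ Y), IsSplitEpi f → HasKernel f

section

variable {A : Type u} [Category.{v} A] [Preadditive A] [HasZeroObject A] [HasBinaryBiproducts A]

/-- `P` is (the class of objects of) a full additive subcategory closed under isomorphisms and
direct summands. -/
structure IsAdditiveSummandClosed (P : ObjectProperty A) : Prop where
  of_iso {Z Z' : A} (e : Z ≅ Z') (h : P Z) : P Z'
  zero : P (0 : A)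
  biprod {Z Z' : A} (h : P Z) (h' : P Z') : P (Z ⊞ Z')
  summand {Z Z' : A} (h : P (Z ⊞ Z')) : P Z

/-- `P` is contravariantly finite: every object has a right `P`-approximation. -/
def ContravariantlyFinite (P : ObjectProperty A) : Prop :=
  ∀ B : A, ∃ (W : A) (t : W ⟶ B), P W ∧
    ∀ (W' : A) (g : W' ⟶ B), P W' → ∃ h : W' ⟶ W, h ≫ t = g

namespace ExactStructure

variable (E : ExactStructure A)

/-- The inflations with cokernel in `P`. -/
def inflationsWithCokernelIn (P : ObjectProperty A) : MorphismProperty A := fun _ Y i =>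
  ∃ (C : A) (c : Y ⟶ C) (w : i ≫ c = 0), E.conflation (ShortComplex.mk i c w) ∧ P C

/-- The deflations with kernel in `P`. -/
def deflationsWithKernelIn (P : ObjectProperty A) : MorphismProperty A := fun X _ d =>
  ∃ (K : A) (k : K ⟶ X) (w : k ≫ d = 0), E.conflation (ShortComplex.mk k d w) ∧ P K

/-! ### Cotorsion pairs -/

/-- `Ext¹(X, Y) = 0`: every extension `Y ⟶ M ⟶ X` is Yoneda-equivalent to the split
extension `Y ⟶ Y ⊞ X ⟶ X`. -/
def ExtOneVanishes (X Y : A) : Prop :=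
  ∀ (M : A) (i : Y ⟶ M) (d : M ⟶ X) (w : i ≫ d = 0), E.conflation (ShortComplex.mk i d w) →
    ∃ φ : M ≅ Y ⊞ X, i ≫ φ.hom = biprod.inl ∧ φ.hom ≫ biprod.snd = d

/-- `(𝒞, ℱ)` is a cotorsion pair: `𝒞 = ^⊥ℱ` and `ℱ = 𝒞^⊥` for `Ext¹`-orthogonality. -/
structure IsCotorsionPair (𝒞 ℱ : ObjectProperty A) : Prop where
  left (X : A) : 𝒞 X ↔ ∀ F : A, ℱ F → E.ExtOneVanishes X F
  right (Y : A) : ℱ Y ↔ ∀ C : A, 𝒞 C → E.ExtOneVanishes C Y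

/-- `(𝒞, ℱ)` is a complete cotorsion pair. -/
structure IsCompleteCotorsionPair (𝒞 ℱ : ObjectProperty A) : Prop
    extends E.IsCotorsionPair 𝒞 ℱ where
  /-- a conflation `F ⟶ C ⟶ X` for every object `X` -/
  cover (X : A) : ∃ (F C : A) (i : F ⟶ C) (d : C ⟶ X) (w : i ≫ d = 0),
    E.conflation (ShortComplex.mk i d w) ∧ 𝒞 C ∧ ℱ F
  /-- a conflation `X ⟶ F' ⟶ C'` for every object `X` -/
  envelope (X : A) : ∃ (F' C' : A) (i : X ⟶ F') (d : F' ⟶ C') (w : i ≫ d = 0),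
    E.conflation (ShortComplex.mk i d w) ∧ 𝒞 C' ∧ ℱ F'

/-- `(𝒞, ℱ)` is a hereditary complete cotorsion pair: moreover `𝒞` is closed under kernels of
deflations and `ℱ` is closed under cokernels of inflations. -/
structure IsHereditaryCompleteCotorsionPair (𝒞 ℱ : ObjectProperty A) : Prop
    extends E.IsCompleteCotorsionPair 𝒞 ℱ where
  kernel_mem (S : ShortComplex A) (hS : E.conflation S) (h₂ : 𝒞 S.X₂) (h₃ : 𝒞 S.X₃) : 𝒞 S.X₁
  cokernel_mem (S : ShortComplex A) (hS : E.conflation S) (h₁ : ℱ S.X₁) (h₂ : ℱ S.X₂) : ℱ S.X₃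

end ExactStructure

/-! ### Model structures -/

/-- `(cof, fib, weq)` is a (closed) model structure; no limits or colimits are required. -/
structure IsModelStructure (cof fib weq : MorphismProperty A) : Prop where
  two_out_of_three : weq.HasTwoOutOfThreeProperty
  retract_cof : cof.IsStableUnderRetracts
  retract_fib : fib.IsStableUnderRetracts
  retract_weq : weq.IsStableUnderRetracts
  lift_trivial_fib {X Y Z T : A} (i : X ⟶ Y) (p : Z ⟶ T) (hi : cof i) (hp : fib p) (hp' : weq p) :
    HasLiftingProperty i p
  lift_trivial_cof {X Y Z T : A} (i : X ⟶ Y) (p : Z ⟶ T) (hi : cof i) (hi' : weq i) (hp : fib p) :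
    HasLiftingProperty i p
  fac_trivial_cof {X Y : A} (f : X ⟶ Y) : ∃ (Z : A) (i : X ⟶ Z) (p : Z ⟶ Y),
    i ≫ p = f ∧ cof i ∧ weq i ∧ fib p
  fac_trivial_fib {X Y : A} (f : X ⟶ Y) : ∃ (Z : A) (j : X ⟶ Z) (q : Z ⟶ Y),
    j ≫ q = f ∧ cof j ∧ fib q ∧ weq q

/-- The cofibrant objects: `0 ⟶ Z` is a cofibration. -/
def cofibrantObjects (cof : MorphismProperty A) : ObjectProperty A :=
  fun Z => cof (0 : (0 : A) ⟶ Z)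

/-- The fibrant objects: `Z ⟶ 0` is a fibration. -/
def fibrantObjects (fib : MorphismProperty A) : ObjectProperty A :=
  fun Z => fib (0 : Z ⟶ (0 : A))

/-- The trivial objects: `0 ⟶ Z` is a weak equivalence. -/
def trivialObjects (weq : MorphismProperty A) : ObjectProperty A :=
  fun Z => weq (0 : (0 : A) ⟶ Z)

/-! ### The three classes of morphisms attached to a pair of subcategories -/

/-- `CoFib_ω`: the inflations with cokernel in `𝒳`. -/
def CoFibω (E : ExactStructure A) (𝒳 : ObjectProperty A) : MorphismProperty A :=
  E.inflationsWithCokernelIn 𝒳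

/-- `Fib_ω`: the `ω`-epic morphisms, for `ω = 𝒳 ∩ 𝒴`. -/
def Fibω (𝒳 𝒴 : ObjectProperty A) : MorphismProperty A := fun B _ f =>
  ∀ W : A, (𝒳 ⊓ 𝒴) W → Function.Surjective (fun h : W ⟶ B => h ≫ f)

/-- `Weq_ω`: the morphisms `f : B ⟶ C` for which some `(f, t) : B ⊞ W ⟶ C` with `W` in
`ω = 𝒳 ∩ 𝒴` is a deflation with kernel in `𝒴`. -/
def Weqω (E : ExactStructure A) (𝒳 𝒴 : ObjectProperty A) : MorphismProperty A := fun _ C f =>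
  ∃ (W : A) (t : W ⟶ C), (𝒳 ⊓ 𝒴) W ∧ E.deflationsWithKernelIn 𝒴 (biprod.desc f t)

/-- The split monomorphisms with cokernel in `P`. -/
def splitMonosWithCokernelIn (P : ObjectProperty A) : MorphismProperty A := fun _ Y f =>
  IsSplitMono f ∧ ∃ (C : A) (c : Y ⟶ C) (w : f ≫ c = 0),
    Nonempty (IsColimit (CokernelCofork.ofπ c w)) ∧ P C

/-! ### Additive quotients -/

/-- Two morphisms of the full subcategory `𝒳` are identified if their difference factors through
an object of `𝒰`. -/
def factorRel (𝒳 𝒰 : ObjectProperty A) : HomRel 𝒳.FullSubcategory := fun Z T f g =>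
  ∃ (W : A) (u : Z.obj ⟶ W) (r : W ⟶ T.obj), 𝒰 W ∧ f.hom - g.hom = u ≫ r

/-- The additive quotient `𝒳/𝒰`, for `𝒰 ⊆ 𝒳`: its objects are those of `𝒳`, and its morphisms are
the classes of morphisms modulo those that factor through an object of `𝒰`. -/
abbrev AdditiveQuotient (𝒳 𝒰 : ObjectProperty A) := Quotient (factorRel 𝒳 𝒰)

/-- If `𝒰` contains zero and is closed under direct sums, the morphisms that factor through `𝒰`
form an ideal, so that no further identifications are made in the quotient. -/
theorem factorRel_congruence (𝒳 𝒰 : ObjectProperty A) (h0 : 𝒰 (0 : A))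
    (hs : ∀ W W' : A, 𝒰 W → 𝒰 W' → 𝒰 (W ⊞ W')) : Congruence (factorRel 𝒳 𝒰) where
  equivalence :=
    { refl := fun f => ⟨0, 0, 0, h0, by simp⟩
      symm := by
        rintro f g ⟨W, a, b, hW, h⟩
        exact ⟨W, -a, b, hW, by rw [Preadditive.neg_comp, ← h, neg_sub]⟩
      trans := by
        rintro f g k ⟨W, a, b, hW, h⟩ ⟨W', a', b', hW', h'⟩
        exact ⟨W ⊞ W', biprod.lift a a', biprod.desc b b', hs _ _ hW hW', by
          rw [biprod.lift_desc, ← h, ← h', sub_add_sub_cancel]⟩ }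
  comp_left := by
    rintro X Y Z f g g' ⟨W, a, b, hW, h⟩
    exact ⟨W, f.hom ≫ a, b, hW, by
      rw [Category.assoc, ← h, Preadditive.comp_sub]; rfl⟩
  comp_right := by
    rintro X Y Z f f' g ⟨W, a, b, hW, h⟩
    exact ⟨W, a, b ≫ g.hom, hW, by
      rw [← Category.assoc, ← h, Preadditive.sub_comp]; rfl⟩

/-- The additive structure of the quotient, for which the projection from `𝒳` is additive: the
group of morphisms is `Hom(Z, T)` modulo the subgroup of the morphisms that factor through `𝒰`. -/
@[reducible]
noncomputable def additiveQuotientPreadditive (𝒳 𝒰 : ObjectProperty A) (h0 : 𝒰 (0 : A))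
    (hs : ∀ W W' : A, 𝒰 W → 𝒰 W' → 𝒰 (W ⊞ W')) : Preadditive (AdditiveQuotient 𝒳 𝒰) :=
  haveI := factorRel_congruence 𝒳 𝒰 h0 hs
  Quotient.preadditive (factorRel 𝒳 𝒰) (by
    rintro X Y f₁ f₂ g₁ g₂ ⟨W, a, b, hW, h⟩ ⟨W', a', b', hW', h'⟩
    exact ⟨W ⊞ W', biprod.lift a a', biprod.desc b b', hs _ _ hW hW', by
      rw [biprod.lift_desc, ← h, ← h']; exact add_sub_add_comm _ _ _ _⟩)

end

end OmegaModel

open OmegaModel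

/-! If a map t : W → B lifts through f : A → B, a shear of A ⊕ W turns (f, t) into (f, 0). For a
fibration f and W in ω such a lift always exists, so a fibration that is a weak equivalence is a
deflation with kernel in `𝒴`. When Ext¹(`𝒳`, `𝒴`) = 0, lifting a cofibration f against (f, t) splits
it, so a trivial cofibration is an inclusion X → X ⊕ W with W in ω.

Given a cotorsion pair, both lifting axioms follow from these descriptions and
`ExtOneVanishes.exists_lift`. One factorization is X → X ⊕ W → Y with W → Y a right ω-approximation;
the other is `exists_factorization`, the usual pushout along an envelope of a kernel. Two out of
three is reduced, by adding objects of ω, to deflations with kernel in `𝒴`: heredity gives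
`weqω_of_precomp`, while covers and a retract argument give `weqω_of_postcomp`.

Given a model structure, lifting against Y → 0 gives Ext¹(`𝒳`, `𝒴`) = 0, and factoring 0 → X and X →
0 gives covers and envelopes. Two out of three closes `𝒴` under cokernels of inflations, which
implies the dual closure of `𝒳` (`IsCompleteCotorsionPair.kernel_mem`). Factoring 0 → B gives an
ω-approximation of B.

For the homotopy category, lifts between covers are unique up to maps through ω. Hence covers define
a functor to `𝒳`/ω; it inverts weak equivalences, and the functor it induces on the localization is
quasi-inverse to the one induced by the inclusion. -/

namespace OmegaModel

/-! ### Kernels, cokernels and biproducts in additive categories. -/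

variable {A : Type u} [Category.{v} A] [Preadditive A]

/-- `i` is a kernel of `d`. -/
structure IsKer {X Y Z : A} (i : X ⟶ Y) (d : Y ⟶ Z) : Prop where
  zero : i ≫ d = 0
  mono : Mono i
  lift {T : A} (f : T ⟶ Y) (hf : f ≫ d = 0) : ∃ g : T ⟶ X, g ≫ i = f

/-- `d` is a cokernel of `i`. -/
structure IsCok {X Y Z : A} (i : X ⟶ Y) (d : Y ⟶ Z) : Prop where
  zero : i ≫ d = 0
  epi : Epi d
  desc {T : A} (f : Y ⟶ T) (hf : i ≫ f = 0) : ∃ g : Z ⟶ T, d ≫ g = f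

theorem IsKer.of_isLimit {X Y Z : A} {i : X ⟶ Y} {d : Y ⟶ Z} (w : i ≫ d = 0)
    (h : IsLimit (KernelFork.ofι i w)) : IsKer i d where
  zero := w
  mono := mono_of_isLimit_fork h
  lift f hf := ⟨_, (KernelFork.IsLimit.lift' h f hf).2⟩

theorem IsCok.of_isColimit {X Y Z : A} {i : X ⟶ Y} {d : Y ⟶ Z} (w : i ≫ d = 0)
    (h : IsColimit (CokernelCofork.ofπ d w)) : IsCok i d where
  zero := w
  epi := epi_of_isColimit_cofork h
  desc f hf := ⟨_, (CokernelCofork.IsColimit.desc' h f hf).2⟩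

theorem IsCok.nonempty_isColimit {X Y Z : A} {i : X ⟶ Y} {d : Y ⟶ Z} (h : IsCok i d) :
    Nonempty (IsColimit (CokernelCofork.ofπ d h.zero)) := by
  have := h.epi
  choose g hg using fun (T : A) (f : Y ⟶ T) hf => h.desc (T := T) f hf
  exact ⟨CokernelCofork.IsColimit.ofπ _ _ (fun f hf => g _ f hf) (fun f hf => hg _ f hf)
    (fun f hf m hm => by rw [← cancel_epi d, hm, hg])⟩

theorem IsKer.ext {X Y Z T : A} {i : X ⟶ Y} {d : Y ⟶ Z} (h : IsKer i d) {a b : T ⟶ X}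
    (hab : a ≫ i = b ≫ i) : a = b :=
  have := h.mono
  (cancel_mono i).1 hab

theorem IsCok.ext {X Y Z T : A} {i : X ⟶ Y} {d : Y ⟶ Z} (h : IsCok i d) {a b : Z ⟶ T}
    (hab : d ≫ a = d ≫ b) : a = b :=
  have := h.epi
  (cancel_epi d).1 hab

theorem IsKer.exists_iso {X X' Y Z : A} {i : X ⟶ Y} {i' : X' ⟶ Y} {d : Y ⟶ Z} (h : IsKer i d)
    (h' : IsKer i' d) : ∃ e : X ≅ X', e.hom ≫ i' = i := by
  obtain ⟨a, ha⟩ := h'.lift i h.zero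
  obtain ⟨b, hb⟩ := h.lift i' h'.zero
  exact ⟨⟨a, b, h.ext (by simp [hb, ha]), h'.ext (by simp [hb, ha])⟩, ha⟩

theorem IsCok.exists_iso {X Y Z Z' : A} {i : X ⟶ Y} {d : Y ⟶ Z} {d' : Y ⟶ Z'} (h : IsCok i d)
    (h' : IsCok i d') : ∃ e : Z ≅ Z', d ≫ e.hom = d' := by
  obtain ⟨a, ha⟩ := h.desc d' h'.zero
  obtain ⟨b, hb⟩ := h'.desc d h.zero
  exact ⟨⟨a, b, h.ext (by simp [reassoc_of% ha, hb]), h'.ext (by simp [reassoc_of% hb, ha])⟩, ha⟩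

theorem isPullback_of {P X Y Z : A} {fst : P ⟶ X} {snd : P ⟶ Y} {f : X ⟶ Z} {g : Y ⟶ Z}
    (w : fst ≫ f = snd ≫ g)
    (lift : ∀ {T : A} (a : T ⟶ X) (b : T ⟶ Y), a ≫ f = b ≫ g → ∃ l, l ≫ fst = a ∧ l ≫ snd = b)
    (ext : ∀ {T : A} (a : T ⟶ P), a ≫ fst = 0 → a ≫ snd = 0 → a = 0) :
    IsPullback fst snd f g := by
  choose l h₁ h₂ using fun (T : A) (a : T ⟶ X) (b : T ⟶ Y) h => lift a b h
  refine ⟨⟨w⟩, ⟨PullbackCone.IsLimit.mk w (fun s => l _ s.fst s.snd s.condition)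
    (fun s => h₁ _ _ _ _) (fun s => h₂ _ _ _ _) (fun s m hm hm' => ?_)⟩⟩
  rw [← sub_eq_zero]
  apply ext <;> simp [Preadditive.sub_comp, h₁, h₂, hm, hm']

theorem isPushout_of {P X Y Z : A} {f : Z ⟶ X} {g : Z ⟶ Y} {inl : X ⟶ P} {inr : Y ⟶ P}
    (w : f ≫ inl = g ≫ inr)
    (desc : ∀ {T : A} (a : X ⟶ T) (b : Y ⟶ T), f ≫ a = g ≫ b → ∃ l, inl ≫ l = a ∧ inr ≫ l = b)
    (ext : ∀ {T : A} (a : P ⟶ T), inl ≫ a = 0 → inr ≫ a = 0 → a = 0) :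
    IsPushout f g inl inr := by
  choose l h₁ h₂ using fun (T : A) (a : X ⟶ T) (b : Y ⟶ T) h => desc a b h
  refine ⟨⟨w⟩, ⟨PushoutCocone.IsColimit.mk w (fun s => l _ s.inl s.inr s.condition)
    (fun s => h₁ _ _ _ _) (fun s => h₂ _ _ _ _) (fun s m hm hm' => ?_)⟩⟩
  rw [← sub_eq_zero]
  apply ext <;> simp [Preadditive.comp_sub, h₁, h₂, hm, hm']

theorem WeaklyIdempotentComplete.exists_isKer (hA : WeaklyIdempotentComplete A) {X Y : A}
    {s : X ⟶ Y} {r : Y ⟶ X} (h : s ≫ r = 𝟙 X) : ∃ (K : A) (k : K ⟶ Y), IsKer k r := by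
  have := hA r ⟨⟨⟨s, h⟩⟩⟩
  exact ⟨kernel r, kernel.ι r, by simp, inferInstance, fun f hf => ⟨kernel.lift r f hf, by simp⟩⟩

variable [HasBinaryBiproducts A]

theorem WeaklyIdempotentComplete.exists_iso (hA : WeaklyIdempotentComplete A) {X Y : A}
    {s : X ⟶ Y} {r : Y ⟶ X} (h : s ≫ r = 𝟙 X) :
    ∃ (K : A) (e : X ⊞ K ≅ Y), biprod.inl ≫ e.hom = s ∧ e.hom ≫ r = biprod.fst := by
  obtain ⟨K, k, hk⟩ := hA.exists_isKer h
  obtain ⟨p, hp⟩ := hk.lift (𝟙 Y - r ≫ s) (by simp [h])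
  refine ⟨K, ⟨biprod.desc s k, biprod.lift r p, ?_, ?_⟩, by simp, by ext <;> simp [h, hk.zero]⟩
  · have h₁ : s ≫ p = 0 := hk.ext (by simp [hp, reassoc_of% h])
    have h₂ : k ≫ p = 𝟙 K := hk.ext (by simp [hp, reassoc_of% hk.zero])
    ext <;> simp [h, hk.zero, h₁, h₂]
  · simp [hp]

/-- The automorphism of `X ⊞ Y` given by `s : Y ⟶ X`. -/
noncomputable def biprodShear {X Y : A} (s : Y ⟶ X) : X ⊞ Y ≅ X ⊞ Y where
  hom := biprod.desc biprod.inl (biprod.inr + s ≫ biprod.inl)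
  inv := biprod.desc biprod.inl (biprod.inr - s ≫ biprod.inl)
  hom_inv_id := by ext <;> simp
  inv_hom_id := by ext <;> simp

/-- This lets a component that factors through `f` be removed or added at will, up to an
automorphism of the source. -/
theorem biprodShear_hom_fst_comp {X Y W : A} (f : X ⟶ Y) (s : W ⟶ X) :
    (biprodShear s).hom ≫ biprod.fst ≫ f = biprod.desc f (s ≫ f) := by
  ext <;> simp [biprodShear]

variable [HasZeroObject A]

/-! ### Elementary theory of exact categories. -/

namespace ExactStructure

variable {E : ExactStructure A}

/-- `i` and `d` are the two maps of a conflation. -/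
def Conf (E : ExactStructure A) {X Y Z : A} (i : X ⟶ Y) (d : Y ⟶ Z) : Prop :=
  ∃ w : i ≫ d = 0, E.conflation (ShortComplex.mk i d w)

theorem isDeflation_iff {X Y : A} {d : X ⟶ Y} :
    IsDeflation E.conflation d ↔ ∃ (K : A) (k : K ⟶ X), E.Conf k d := Iff.rfl

theorem isInflation_iff {X Y : A} {i : X ⟶ Y} :
    IsInflation E.conflation i ↔ ∃ (C : A) (c : Y ⟶ C), E.Conf i c := Iff.rfl

theorem deflationsWithKernelIn_iff {P : ObjectProperty A} {X Y : A} {d : X ⟶ Y} :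
    E.deflationsWithKernelIn P d ↔ ∃ (K : A) (k : K ⟶ X), E.Conf k d ∧ P K := by
  constructor
  · rintro ⟨K, k, w, h, hK⟩
    exact ⟨K, k, ⟨w, h⟩, hK⟩
  · rintro ⟨K, k, ⟨w, h⟩, hK⟩
    exact ⟨K, k, w, h, hK⟩

theorem inflationsWithCokernelIn_iff {P : ObjectProperty A} {X Y : A} {i : X ⟶ Y} :
    E.inflationsWithCokernelIn P i ↔ ∃ (C : A) (c : Y ⟶ C), E.Conf i c ∧ P C := by
  constructor
  · rintro ⟨K, k, w, h, hK⟩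
    exact ⟨K, k, ⟨w, h⟩, hK⟩
  · rintro ⟨K, k, ⟨w, h⟩, hK⟩
    exact ⟨K, k, w, h, hK⟩

namespace Conf

variable {X Y Z : A} {i : X ⟶ Y} {d : Y ⟶ Z}

theorem isKer (h : E.Conf i d) : IsKer i d :=
  have ⟨_, h⟩ := h
  .of_isLimit _ (E.isKernel _ h).some

theorem isCok (h : E.Conf i d) : IsCok i d :=
  have ⟨_, h⟩ := h
  .of_isColimit _ (E.isCokernel _ h).some

theorem zero (h : E.Conf i d) : i ≫ d = 0 := h.isKer.zero

theorem isDeflation (h : E.Conf i d) : IsDeflation E.conflation d := ⟨_, _, h⟩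

theorem isInflation (h : E.Conf i d) : IsInflation E.conflation i := ⟨_, _, h⟩

theorem of_iso (h : E.Conf i d) {X' Y' Z' : A} {i' : X' ⟶ Y'} {d' : Y' ⟶ Z'} (a : X ≅ X')
    (b : Y ≅ Y') (c : Z ≅ Z') (hi : a.hom ≫ i' = i ≫ b.hom) (hd : b.hom ≫ d' = d ≫ c.hom) :
    E.Conf i' d' := by
  obtain ⟨w, h⟩ := h
  have w' : i' ≫ d' = 0 := by
    rw [← cancel_epi a.hom, reassoc_of% hi, hd, reassoc_of% w]; simp
  exact ⟨w', E.of_iso _ _ (ShortComplex.isoMk a b c hi hd) h⟩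

end Conf

theorem _root_.OmegaModel.IsKer.conf {X Y Z : A} {i : X ⟶ Y} {d : Y ⟶ Z} (h : IsKer i d)
    (hd : IsDeflation E.conflation d) : E.Conf i d := by
  obtain ⟨K, k, hk⟩ := isDeflation_iff.1 hd
  obtain ⟨e, he⟩ := hk.isKer.exists_iso h
  exact hk.of_iso e (Iso.refl _) (Iso.refl _) (by simp [he]) (by simp)

theorem _root_.OmegaModel.IsCok.conf {X Y Z : A} {i : X ⟶ Y} {d : Y ⟶ Z} (h : IsCok i d)
    (hi : IsInflation E.conflation i) : E.Conf i d := by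
  obtain ⟨K, k, hk⟩ := isInflation_iff.1 hi
  obtain ⟨e, he⟩ := hk.isCok.exists_iso h
  exact hk.of_iso (Iso.refl _) (Iso.refl _) e (by simp) (by simp [he])

/-- The axiom provides one pullback that is a deflation; uniqueness of pullbacks transfers this to
any given square, and pulling back does not change the kernel. -/
theorem Conf.of_isPullback {K X Y Z T : A} {k : K ⟶ Y} {d : Y ⟶ Z} (h : E.Conf k d) {f' : X ⟶ Y}
    {d' : X ⟶ T} {f : T ⟶ Z} (sq : IsPullback f' d' d f) :
    ∃ k' : K ⟶ X, E.Conf k' d' ∧ k' ≫ f' = k := by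
  refine ⟨sq.lift k 0 (by simp [h.zero]), IsKer.conf ⟨by simp, ⟨fun a b hab => ?_⟩,
    fun g hg => ?_⟩ ?_, by simp⟩
  · exact h.isKer.ext (by simpa using hab =≫ f')
  · obtain ⟨l, hl⟩ := h.isKer.lift (g ≫ f') (by simp [sq.w, reassoc_of% hg])
    exact ⟨l, sq.hom_ext (by simp [hl]) (by simp [hg])⟩
  · obtain ⟨Y', a, b, sq', K', k', hb⟩ := E.pullback d f h.isDeflation
    have hb : E.Conf k' b := hb
    exact (hb.of_iso (Iso.refl _) (sq'.isoIsPullback _ _ sq) (Iso.refl _)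
      (i' := k' ≫ (sq'.isoIsPullback _ _ sq).hom) (by simp) (by simp)).isDeflation

theorem Conf.exists_pullback {K Y Z T : A} {k : K ⟶ Y} {d : Y ⟶ Z} (h : E.Conf k d) (f : T ⟶ Z) :
    ∃ (X : A) (f' : X ⟶ Y) (d' : X ⟶ T) (k' : K ⟶ X),
      IsPullback f' d' d f ∧ E.Conf k' d' ∧ k' ≫ f' = k := by
  obtain ⟨Y', a, b, sq', -⟩ := E.pullback d f h.isDeflation
  obtain ⟨k', h₁, h₂⟩ := h.of_isPullback sq'
  exact ⟨_, _, _, k', sq', h₁, h₂⟩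

theorem Conf.of_isPushout {X Y C T Z : A} {i : X ⟶ Y} {c : Y ⟶ C} (h : E.Conf i c) {f : X ⟶ T}
    {f' : Y ⟶ Z} {i' : T ⟶ Z} (sq : IsPushout i f f' i') :
    ∃ c' : Z ⟶ C, E.Conf i' c' ∧ f' ≫ c' = c := by
  refine ⟨sq.desc c 0 (by simp [h.zero]), IsCok.conf ⟨by simp, ⟨fun a b hab => ?_⟩,
    fun g hg => ?_⟩ ?_, by simp⟩
  · exact h.isCok.ext (by simpa using f' ≫= hab)
  · obtain ⟨l, hl⟩ := h.isCok.desc (f' ≫ g) (by simp [reassoc_of% sq.w, hg])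
    exact ⟨l, sq.hom_ext (by simp [hl]) (by simp [hg])⟩
  · obtain ⟨Y', a, b, sq', K', k', hb⟩ := E.pushout i f h.isInflation
    have hb : E.Conf b k' := hb
    exact (hb.of_iso (Iso.refl _) (sq'.isoIsPushout _ _ sq) (Iso.refl _)
      (d' := (sq'.isoIsPushout _ _ sq).inv ≫ k') (by simp) (by simp)).isInflation

theorem Conf.exists_pushout {X Y C T : A} {i : X ⟶ Y} {c : Y ⟶ C} (h : E.Conf i c) (f : X ⟶ T) :
    ∃ (Z : A) (f' : Y ⟶ Z) (i' : T ⟶ Z) (c' : Z ⟶ C),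
      IsPushout i f f' i' ∧ E.Conf i' c' ∧ f' ≫ c' = c := by
  obtain ⟨Y', a, b, sq', -⟩ := E.pushout i f h.isInflation
  obtain ⟨k', h₁, h₂⟩ := h.of_isPushout sq'
  exact ⟨_, _, _, k', sq', h₁, h₂⟩

theorem isDeflation_of_isIso {X Y : A} (f : X ⟶ Y) [IsIso f] : IsDeflation E.conflation f := by
  obtain ⟨K, k, h⟩ := isDeflation_iff.1 E.id_zero
  have sq : IsPullback (0 : X ⟶ (0 : A)) f (𝟙 0) 0 :=
    isPullback_of (by simp) (fun a b _ => ⟨b ≫ inv f, by ext, by simp⟩)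
      (fun a _ h => (cancel_mono f).1 (by simp [h]))
  obtain ⟨k', h', -⟩ := h.of_isPullback sq
  exact h'.isDeflation

theorem isInflation_of_isIso {X Y : A} (f : X ⟶ Y) [IsIso f] : IsInflation E.conflation f := by
  have h : E.Conf (𝟙 (0 : A)) (𝟙 (0 : A)) :=
    IsKer.conf ⟨by ext, inferInstance, fun f _ => ⟨f, by ext⟩⟩ E.id_zero
  have sq : IsPushout (𝟙 (0 : A)) 0 (0 : 0 ⟶ Y) f :=
    isPushout_of (by simp) (fun a b _ => ⟨inv f ≫ b, by ext, by simp⟩)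
      (fun a _ h => (cancel_epi f).1 (by simp [h]))
  obtain ⟨k', h', -⟩ := h.of_isPushout sq
  exact h'.isInflation

theorem conf_zero_of_isIso {X Y Z : A} (hZ : IsZero Z) (i : Z ⟶ X) (f : X ⟶ Y) [IsIso f] :
    E.Conf i f :=
  IsKer.conf ⟨hZ.eq_of_src _ _, ⟨fun _ _ _ => hZ.eq_of_tgt _ _⟩,
    fun g hg => ⟨0, by rw [← cancel_mono f, hg]; simp [hZ.eq_of_src i 0]⟩⟩ (isDeflation_of_isIso f)

theorem conf_of_isIso_zero {X Y Z : A} (hZ : IsZero Z) (f : X ⟶ Y) [IsIso f] (d : Y ⟶ Z) :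
    E.Conf f d :=
  IsCok.conf ⟨hZ.eq_of_tgt _ _, ⟨fun _ _ _ => hZ.eq_of_src _ _⟩,
    fun g hg => ⟨0, by rw [← cancel_epi f, hg]; simp [hZ.eq_of_tgt d 0]⟩⟩ (isInflation_of_isIso f)

theorem conf_inr_fst (X Y : A) : E.Conf (biprod.inr : Y ⟶ X ⊞ Y) biprod.fst := by
  have h : E.Conf (𝟙 Y) (0 : Y ⟶ (0 : A)) := conf_of_isIso_zero (isZero_zero A) _ _
  have sq : IsPullback (biprod.snd : X ⊞ Y ⟶ Y) biprod.fst (0 : Y ⟶ (0 : A)) 0 :=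
    isPullback_of (by simp) (fun a b _ => ⟨biprod.lift b a, by simp, by simp⟩)
      (fun a h h' => by ext <;> simp [h, h'])
  obtain ⟨k, hk, hk'⟩ := h.of_isPullback sq
  convert hk
  ext <;> simp [hk', hk.zero]

theorem conf_inl_snd (X Y : A) : E.Conf (biprod.inl : X ⟶ X ⊞ Y) biprod.snd :=
  (conf_inr_fst Y X).of_iso (Iso.refl _) (biprod.braiding _ _) (Iso.refl _) (by ext <;> simp)
    (by simp)

theorem isDeflation_fst (X Y : A) : IsDeflation E.conflation (biprod.fst : X ⊞ Y ⟶ X) :=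
  (conf_inr_fst X Y).isDeflation

theorem Conf.biprod_map_id {K X Y : A} {k : K ⟶ X} {d : X ⟶ Y} (h : E.Conf k d) (W : A) :
    E.Conf (k ≫ biprod.inl) (biprod.map d (𝟙 W)) := by
  have sq : IsPullback biprod.fst (biprod.map d (𝟙 W)) d biprod.fst :=
    isPullback_of (by simp) (fun a b h => ⟨biprod.lift a (b ≫ biprod.snd), by simp, by
      ext <;> simp [h]⟩) (fun a h h' => by
        have := h' =≫ biprod.snd
        ext
        · simpa using h
        · simpa using this)
  obtain ⟨k', h', h''⟩ := h.of_isPullback sq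
  convert h'
  have := h'.zero =≫ biprod.snd
  ext <;> simp_all

theorem Conf.id_biprod_map {K X Y : A} {k : K ⟶ X} {d : X ⟶ Y} (h : E.Conf k d) (W : A) :
    E.Conf (k ≫ biprod.inr) (biprod.map (𝟙 W) d) :=
  (h.biprod_map_id W).of_iso (Iso.refl _) (biprod.braiding _ _) (biprod.braiding _ _)
    (by ext <;> simp) (by ext <;> simp)

/-- For a pushout of an inflation, the sequence `X ⟶ Y ⊞ T ⟶ Z` ends with a deflation. -/
theorem isDeflation_desc_of_isPushout {X Y T Z : A} {i : X ⟶ Y} {f : X ⟶ T} {f' : Y ⟶ Z}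
    {i' : T ⟶ Z} (sq : IsPushout i f f' i') (hi : IsInflation E.conflation i) :
    IsDeflation E.conflation (biprod.desc f' i') := by
  obtain ⟨C, c, h⟩ := isInflation_iff.1 hi
  obtain ⟨c', h', hc⟩ := h.of_isPushout sq
  -- The map in question is the base change along `c'` of the deflation `c`, because `i` and `i'`
  -- have the same cokernel.
  have sq' : IsPullback biprod.fst (biprod.desc f' i') c c' := by
    refine isPullback_of (by ext <;> simp [hc, h'.zero]) (fun a b hab => ?_) (fun a h₁ h₂ => ?_)
    · obtain ⟨x, hx⟩ := h'.isKer.lift (b - a ≫ f') (by simp [hc, hab])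
      exact ⟨biprod.lift a x, by simp, by simp [hx]⟩
    · have h₃ : (a ≫ biprod.snd) ≫ i' = 0 ≫ i' := by
        rw [biprod.desc_eq, Preadditive.comp_add, reassoc_of% h₁] at h₂
        simpa using h₂
      have := h'.isKer.ext h₃
      ext <;> simp [h₁, this]
  obtain ⟨k, hk, -⟩ := h.of_isPullback sq'
  exact hk.isDeflation

/-- Only deflations are composable by axiom. Push `j` out along the cokernel `p` of `i`, with `q : Z
⟶ Z'`. The deflation Z ⊕ Y → Z ⊕ C → Z' becomes (q, 0) after a shear, and its kernel is (`i ≫ j`) ⊕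
1. A pushout along the projection X ⊕ Y → X removes the summand Y. -/
theorem isInflation_comp {X Y Z : A} {i : X ⟶ Y} {j : Y ⟶ Z} (hi : IsInflation E.conflation i)
    (hj : IsInflation E.conflation j) : IsInflation E.conflation (i ≫ j) := by
  obtain ⟨C, p, hp⟩ := isInflation_iff.1 hi
  obtain ⟨D, c, hc⟩ := isInflation_iff.1 hj
  obtain ⟨Z', q, j', c', sq, hj', hq⟩ := hc.exists_pushout p
  have h₁ := isDeflation_desc_of_isPushout sq hj
  have h₂ := E.comp _ _ (hp.id_biprod_map Z).isDeflation h₁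
  have ker : IsKer (biprod.map (i ≫ j) (𝟙 Y)) (biprod.fst ≫ q : Z ⊞ Y ⟶ Z') := by
    refine ⟨?_, ⟨fun a b hab => ?_⟩, fun f hf => ?_⟩
    · ext <;> simp [sq.w, reassoc_of% hp.zero]
    · have e₁ := hab =≫ biprod.fst
      have e₂ := hab =≫ biprod.snd
      simp only [Category.assoc, biprod.map_fst, biprod.map_snd, Category.comp_id] at e₁ e₂
      simp only [← Category.assoc] at e₁
      ext
      · exact hp.isKer.ext (hc.isKer.ext e₁)
      · exact e₂
    · obtain ⟨y, hy⟩ := hc.isKer.lift (f ≫ biprod.fst) (by simpa [hq] using hf =≫ c')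
      obtain ⟨x, hx⟩ := hp.isKer.lift y (hj'.isKer.ext (by
        simp only [Category.assoc, ← sq.w, reassoc_of% hy, hf, zero_comp]))
      exact ⟨biprod.lift x (f ≫ biprod.snd), by ext <;> simp [reassoc_of% hx, hy]⟩
  have hdef : IsDeflation E.conflation (biprod.fst ≫ q : Z ⊞ Y ⟶ Z') := by
    have := E.comp _ _ (isDeflation_of_isIso (biprodShear (-j)).hom) h₂
    convert this using 1
    ext <;> simp [biprodShear, sq.w, biprod.map_eq]
  have sq' : IsPushout (biprod.map (i ≫ j) (𝟙 Y)) biprod.fst biprod.fst (i ≫ j) :=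
    isPushout_of (by simp) (fun a b hab => ⟨biprod.inl ≫ a, by
      have := biprod.inr ≫= hab
      ext <;> simp at this ⊢
      exact this.symm, by
      have := biprod.inl ≫= hab
      simpa using this⟩) (fun a h _ => by simpa using biprod.inl ≫= h)
  obtain ⟨_, h, -⟩ := (ker.conf hdef).of_isPushout sq'
  exact h.isInflation

/-- The map is the composite of `f` ⊕ 1, a shear of Z ⊕ Y and the projection to Z. -/
theorem isDeflation_desc {X Y Z : A} {f : X ⟶ Z} (hf : IsDeflation E.conflation f) (g : Y ⟶ Z) :
    IsDeflation E.conflation (biprod.desc f g) := by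
  obtain ⟨K, k, hk⟩ := isDeflation_iff.1 hf
  have := E.comp _ _ (hk.biprod_map_id Y).isDeflation
    (E.comp _ _ (isDeflation_of_isIso (biprodShear g).hom) (isDeflation_fst _ _))
  convert this using 1
  ext <;> simp [biprodShear]

theorem Conf.biprod_map_id_fst {X Y Z : A} {i : X ⟶ Y} {c : Y ⟶ Z} (h : E.Conf i c) (W : A) :
    E.Conf (biprod.map i (𝟙 W)) (biprod.fst ≫ c) := by
  have ker : IsKer (biprod.map i (𝟙 W)) (biprod.fst ≫ c) := by
    refine ⟨by ext <;> simp [h.zero], ⟨fun a b hab => ?_⟩, fun f hf => ?_⟩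
    · have e₁ := hab =≫ biprod.fst
      have e₂ := hab =≫ biprod.snd
      simp only [Category.assoc, biprod.map_fst, biprod.map_snd, Category.comp_id] at e₁ e₂
      simp only [← Category.assoc] at e₁
      ext
      · exact h.isKer.ext e₁
      · exact e₂
    · obtain ⟨y, hy⟩ := h.isKer.lift (f ≫ biprod.fst) (by simpa using hf)
      exact ⟨biprod.lift y (f ≫ biprod.snd), by ext <;> simp [hy]⟩
  exact ker.conf (E.comp _ _ (isDeflation_fst _ _) h.isDeflation)

theorem isInflation_lift {X Y Z : A} {f : X ⟶ Y} (hf : IsInflation E.conflation f) (g : X ⟶ Z) :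
    IsInflation E.conflation (biprod.lift f g) := by
  obtain ⟨K, k, hk⟩ := isInflation_iff.1 hf
  have := isInflation_comp (conf_inr_fst Z X).isInflation
    (isInflation_comp (isInflation_of_isIso (E := E) (biprodShear g).hom)
      (isInflation_comp (isInflation_of_isIso (E := E) (biprod.braiding _ _).hom)
        (hk.biprod_map_id_fst Z).isInflation))
  convert this using 1
  ext <;> simp [biprodShear]

/-- The kernels of two composable deflations and of their composite form a conflation. -/
theorem Conf.exists_comp {K L X Y Z : A} {k : K ⟶ X} {d : X ⟶ Y} {l : L ⟶ Y} {e : Y ⟶ Z}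
    (hd : E.Conf k d) (he : E.Conf l e) : ∃ (P : A) (m : P ⟶ X) (k' : K ⟶ P) (d' : P ⟶ L),
      E.Conf m (d ≫ e) ∧ E.Conf k' d' ∧ k' ≫ m = k ∧ m ≫ d = d' ≫ l := by
  obtain ⟨P, m, d', k', sq, h, hk⟩ := hd.exists_pullback l
  refine ⟨P, m, k', d', IsKer.conf ⟨by rw [reassoc_of% sq.w, he.zero, comp_zero],
    ⟨fun a b hab => sq.hom_ext hab (he.isKer.ext ?_)⟩, fun f hf => ?_⟩
    (E.comp _ _ hd.isDeflation he.isDeflation), h, hk, sq.w⟩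
  · simp only [Category.assoc, ← sq.w, reassoc_of% hab]
  · obtain ⟨g, hg⟩ := he.isKer.lift (f ≫ d) (by simpa using hf)
    exact ⟨sq.lift f g hg.symm, by simp⟩

/-- The cokernels of two composable inflations and of their composite form a conflation. -/
theorem Conf.exists_comp_inflation {C D X Y Z : A} {i : X ⟶ Y} {c : Y ⟶ C} {j : Y ⟶ Z} {d : Z ⟶ D}
    (hi : E.Conf i c) (hj : E.Conf j d) : ∃ (P : A) (m : Z ⟶ P) (j' : C ⟶ P) (d' : P ⟶ D),
      E.Conf (i ≫ j) m ∧ E.Conf j' d' ∧ m ≫ d' = d ∧ j ≫ m = c ≫ j' := by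
  obtain ⟨P, m, j', d', sq, h, hk⟩ := hj.exists_pushout c
  refine ⟨P, m, j', d', IsCok.conf ⟨by rw [Category.assoc, sq.w, reassoc_of% hi.zero, zero_comp],
    ⟨fun a b hab => sq.hom_ext hab (hi.isCok.ext ?_)⟩, fun f hf => ?_⟩
    (isInflation_comp hi.isInflation hj.isInflation), h, hk, sq.w⟩
  · simp only [← Category.assoc, ← sq.w]
    simp only [Category.assoc, hab]
  · obtain ⟨g, hg⟩ := hi.isCok.desc (j ≫ f) (by simpa using hf)
    exact ⟨sq.desc f g hg.symm, by simp⟩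

end ExactStructure

theorem IsAdditiveSummandClosed.of_retract {P : ObjectProperty A} (hP : IsAdditiveSummandClosed P)
    (hA : WeaklyIdempotentComplete A) {X Y : A} {s : X ⟶ Y} {r : Y ⟶ X} (h : s ≫ r = 𝟙 X)
    (hY : P Y) : P X := by
  obtain ⟨K, e, -⟩ := hA.exists_iso h
  exact hP.summand (hP.of_iso e.symm hY)

/-! ### Cancellation of deflations and inflations. -/

namespace ExactStructure

variable {E : ExactStructure A}

/-- The pullback of `f ≫ d` along `d` projects to X by a split epimorphism, whose kernel exists by
weak idempotent completeness and is also a kernel of `d`. A shear turns the deflation (`f ≫ d`, `d`)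
into (0, `d`), with kernel 1 ⊕ ker `d`; a pushout then removes the summand X. -/
theorem isDeflation_of_comp (hA : WeaklyIdempotentComplete A) {X Y Z : A} {f : X ⟶ Y} {d : Y ⟶ Z}
    (h : IsDeflation E.conflation (f ≫ d)) : IsDeflation E.conflation d := by
  obtain ⟨L, l, hl⟩ := isDeflation_iff.1 h
  obtain ⟨P, b, a, l', sq, -, -⟩ := hl.exists_pullback d
  obtain ⟨K, k, hk⟩ := hA.exists_isKer (r := b) (s := sq.lift (𝟙 X) f (by simp)) (by simp)
  have ker : IsKer (k ≫ a) d := by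
    refine ⟨by rw [Category.assoc, ← sq.w, reassoc_of% hk.zero, zero_comp], ⟨fun x y hxy => ?_⟩,
      fun g hg => ?_⟩
    · exact hk.ext (sq.hom_ext (by simp [hk.zero]) (by simpa using hxy))
    · obtain ⟨x, hx⟩ := hk.lift (sq.lift 0 g (by simp [hg])) (by simp)
      exact ⟨x, by rw [reassoc_of% hx]; simp⟩
  have hdef : IsDeflation E.conflation (biprod.snd ≫ d : X ⊞ Y ⟶ Z) := by
    have := E.comp _ _ (isDeflation_of_isIso
      ((biprod.braiding X Y).hom ≫ (biprodShear (-f)).hom ≫ (biprod.braiding Y X).hom))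
      (isDeflation_desc h d)
    convert this using 1
    ext <;> simp [biprodShear]
  have ker' : IsKer (biprod.map (𝟙 X) (k ≫ a)) (biprod.snd ≫ d) := by
    refine ⟨by ext <;> simp [ker.zero], ⟨fun x y hxy => ?_⟩, fun f hf => ?_⟩
    · have e₁ := hxy =≫ biprod.fst
      have e₂ := hxy =≫ biprod.snd
      simp only [Category.assoc, biprod.map_fst, biprod.map_snd, Category.comp_id] at e₁ e₂
      ext
      · exact e₁
      · exact ker.ext (by simpa using e₂)
    · obtain ⟨y, hy⟩ := ker.lift (f ≫ biprod.snd) (by simpa using hf)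
      exact ⟨biprod.lift (f ≫ biprod.fst) y, by ext <;> simp [hy]⟩
  have sq' : IsPushout (biprod.map (𝟙 X) (k ≫ a)) biprod.snd biprod.snd (k ≫ a) :=
    isPushout_of (by simp) (fun a b hab => ⟨biprod.inr ≫ a, by
      have := biprod.inl ≫= hab
      ext <;> simp at this ⊢
      exact this.symm, by
      have := biprod.inr ≫= hab
      simpa using this⟩) (fun a h _ => by simpa using biprod.inr ≫= h)
  obtain ⟨c, hc, hc'⟩ := (ker'.conf hdef).of_isPushout sq'
  have : c = d := by simpa using biprod.inr ≫= hc'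
  exact this ▸ hc.isDeflation

theorem isInflation_of_comp (hA : WeaklyIdempotentComplete A) {X Y Z : A} {i : X ⟶ Y} {f : Y ⟶ Z}
    (h : IsInflation E.conflation (i ≫ f)) : IsInflation E.conflation i := by
  obtain ⟨L, l, hl⟩ := isInflation_iff.1 h
  obtain ⟨P, a, b, l', sq, -, -⟩ := hl.exists_pushout i
  obtain ⟨K, e, he, he'⟩ := hA.exists_iso (s := a) (r := sq.desc (𝟙 Z) f (by simp)) (by simp)
  have cok : IsCok i (b ≫ e.inv ≫ biprod.snd) := by
    have ha : a ≫ e.inv ≫ biprod.snd = 0 := by rw [← he]; simp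
    refine ⟨by rw [← reassoc_of% sq.w, ha]; simp, ⟨fun x y hxy => ?_⟩,
      fun g hg => ?_⟩
    · have : e.inv ≫ biprod.snd ≫ x = e.inv ≫ biprod.snd ≫ y :=
        sq.hom_ext (by rw [reassoc_of% ha, reassoc_of% ha]; simp) (by simpa using hxy)
      simpa using biprod.inr ≫= e.hom ≫= this
    · refine ⟨biprod.inr ≫ e.hom ≫ sq.desc 0 g (by simp [hg]), ?_⟩
      have : biprod.snd ≫ biprod.inr ≫ e.hom ≫ sq.desc 0 g (by simp [hg]) =
          e.hom ≫ sq.desc 0 g (by simp [hg]) := by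
        ext
        · simp [reassoc_of% he]
        · simp
      simp [this]
  have hinf : IsInflation E.conflation (i ≫ (biprod.inr : Y ⟶ Z ⊞ Y)) := by
    have := isInflation_comp (isInflation_lift h i) (isInflation_of_isIso (biprodShear (-f)).hom)
    convert this using 1
    ext <;> simp [biprodShear, biprod.lift_eq]
  have cok' : IsCok (i ≫ biprod.inr) (biprod.map (𝟙 Z) (b ≫ e.inv ≫ biprod.snd)) := by
    refine ⟨by simp [reassoc_of% cok.zero], ⟨fun x y hxy => ?_⟩, fun f hf => ?_⟩
    · have e₁ := biprod.inl ≫= hxy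
      have e₂ := biprod.inr ≫= hxy
      ext
      · simpa using e₁
      · exact cok.ext (by simpa using e₂)
    · obtain ⟨y, hy⟩ := cok.desc (biprod.inr ≫ f) (by simpa using hf)
      exact ⟨biprod.desc (biprod.inl ≫ f) y, by ext <;> simp [hy]⟩
  have sq' : IsPullback biprod.inr (b ≫ e.inv ≫ biprod.snd)
      (biprod.map (𝟙 Z) (b ≫ e.inv ≫ biprod.snd)) biprod.inr :=
    isPullback_of (by simp) (fun x y hxy => ⟨x ≫ biprod.snd, by
      have := hxy =≫ biprod.fst
      ext <;> simp at this ⊢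
      exact this.symm, by
      have := hxy =≫ biprod.snd
      simpa using this⟩) (fun a h _ => by simpa using h =≫ biprod.snd)
  obtain ⟨c, hc, hc'⟩ := (cok'.conf hinf).of_isPullback sq'
  have : c = i := by simpa using hc' =≫ biprod.snd
  exact this ▸ hc.isInflation

/-! ### Vanishing of Ext¹ and lifting properties. -/

namespace ExtOneVanishes

theorem exists_section {X Y M : A} (h : E.ExtOneVanishes X Y) {i : Y ⟶ M} {d : M ⟶ X}
    (hc : E.Conf i d) : ∃ s : X ⟶ M, s ≫ d = 𝟙 X := by
  obtain ⟨w, hc⟩ := hc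
  obtain ⟨φ, -, hφ⟩ := h M i d w hc
  exact ⟨biprod.inr ≫ φ.inv, by simp [← hφ]⟩

theorem exists_retraction {X Y M : A} (h : E.ExtOneVanishes X Y) {i : Y ⟶ M} {d : M ⟶ X}
    (hc : E.Conf i d) : ∃ r : M ⟶ Y, i ≫ r = 𝟙 Y := by
  obtain ⟨w, hc⟩ := hc
  obtain ⟨φ, hφ, -⟩ := h M i d w hc
  exact ⟨φ.hom ≫ biprod.fst, by simp [reassoc_of% hφ]⟩

theorem of_section {X Y : A}
    (h : ∀ {M : A} {i : Y ⟶ M} {d : M ⟶ X}, E.Conf i d → ∃ s : X ⟶ M, s ≫ d = 𝟙 X) :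
    E.ExtOneVanishes X Y := by
  intro M i d w hc
  have hc : E.Conf i d := ⟨w, hc⟩
  obtain ⟨s, hs⟩ := h hc
  obtain ⟨p, hp⟩ := hc.isKer.lift (𝟙 M - d ≫ s) (by simp [hs])
  have h₁ : i ≫ p = 𝟙 Y := hc.isKer.ext (by simp [hp, reassoc_of% hc.zero])
  have h₂ : s ≫ p = 0 := hc.isKer.ext (by simp [hp, reassoc_of% hs])
  refine ⟨⟨biprod.lift p d, biprod.desc i s, by simp [hp], ?_⟩, ?_, by simp⟩
  · ext <;> simp [h₁, h₂, hs, hc.zero]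
  · ext <;> simp [h₁, hc.zero]

theorem of_retraction {X Y : A}
    (h : ∀ {M : A} {i : Y ⟶ M} {d : M ⟶ X}, E.Conf i d → ∃ r : M ⟶ Y, i ≫ r = 𝟙 Y) :
    E.ExtOneVanishes X Y := by
  refine of_section fun {M i d} hc => ?_
  obtain ⟨r, hr⟩ := h hc
  obtain ⟨s, hs⟩ := hc.isCok.desc (𝟙 M - r ≫ i) (by simp [reassoc_of% hr])
  exact ⟨s, hc.isCok.ext (by simp [reassoc_of% hs, hc.zero])⟩

/-- An inflation `i` with cokernel `X` has the left lifting property with respect to a deflation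
with kernel `Y` if `Ext¹(X, Y) = 0`. -/
theorem exists_lift {X Y B C P Q : A} (h : E.ExtOneVanishes X Y) {i : B ⟶ C} {c : C ⟶ X}
    {k : Y ⟶ P} {p : P ⟶ Q} (hi : E.Conf i c) (hp : E.Conf k p) (a : B ⟶ P) (b : C ⟶ Q)
    (w : a ≫ p = i ≫ b) : ∃ l : C ⟶ P, i ≫ l = a ∧ l ≫ p = b := by
  -- After base change along `b`, it remains to find a section of `q` that restricts to `a'` on B.
  obtain ⟨Z, f, q, k', sq, hq, hk'⟩ := hp.exists_pullback b
  let a' : B ⟶ Z := sq.lift a i w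
  have ha' : a' ≫ q = i := by simp [a']
  have ha'' : a' ≫ f = a := by simp [a']
  have ker : IsKer (biprod.desc a' k') (q ≫ c) := by
    refine ⟨?_, ?_, fun g hg => ?_⟩
    · ext
      · simp [reassoc_of% ha', hi.zero]
      · simp [reassoc_of% hq.zero]
    · refine Preadditive.mono_of_cancel_zero _ fun g hg => ?_
      have h₁ : g ≫ biprod.fst = 0 := hi.isKer.ext (by
        simpa [biprod.desc_eq, hq.zero, ha'] using hg =≫ q)
      have h₂ : g ≫ biprod.snd = 0 := hq.isKer.ext (by
        simpa [biprod.desc_eq, reassoc_of% h₁] using hg)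
      ext <;> simp [h₁, h₂]
    · obtain ⟨x, hx⟩ := hi.isKer.lift (g ≫ q) (by simpa using hg)
      obtain ⟨y, hy⟩ := hq.isKer.lift (g - x ≫ a') (by simp [ha', hx])
      exact ⟨biprod.lift x y, by simp [hy]⟩
  -- Killing B in the kernel B ⊕ Y of Z → X yields an extension of X by Y. Its retraction gives a
  -- map Z → Y that is zero on `a'` and the identity on `k'`; the complementary idempotent of Z
  -- factors through `q` and provides the section.
  obtain ⟨M, u, j, e, sq', hj, -⟩ :=
    (ker.conf (E.comp _ _ hq.isDeflation hi.isDeflation)).exists_pushout biprod.snd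
  obtain ⟨r, hr⟩ := h.exists_retraction hj
  have h₁ : a' ≫ u ≫ r = 0 := by simpa using biprod.inl ≫= sq'.w =≫ r
  have h₂ : k' ≫ u ≫ r = 𝟙 Y := by simpa [hr] using biprod.inr ≫= sq'.w =≫ r
  obtain ⟨s, hs⟩ := hq.isCok.desc (𝟙 Z - u ≫ r ≫ k') (by simp [reassoc_of% h₂])
  have hsq : s ≫ q = 𝟙 C := hq.isCok.ext (by simp [reassoc_of% hs, hq.zero])
  refine ⟨s ≫ f, ?_, by simp [sq.w, reassoc_of% hsq]⟩
  rw [← ha', Category.assoc, reassoc_of% hs, Preadditive.sub_comp, Preadditive.comp_sub]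
  simp [reassoc_of% h₁, ha'']

theorem exists_lift_of_source {X Y P Q : A} (h : E.ExtOneVanishes X Y) {k : Y ⟶ P} {p : P ⟶ Q}
    (hp : E.Conf k p) (b : X ⟶ Q) : ∃ l : X ⟶ P, l ≫ p = b := by
  obtain ⟨l, -, hl⟩ := h.exists_lift (conf_zero_of_isIso (isZero_zero A) 0 (𝟙 X)) hp 0 b (by simp)
  exact ⟨l, hl⟩

theorem exists_extension {X Y B C : A} (h : E.ExtOneVanishes X Y) {i : B ⟶ C} {c : C ⟶ X}
    (hi : E.Conf i c) (a : B ⟶ Y) : ∃ l : C ⟶ Y, i ≫ l = a := by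
  obtain ⟨l, hl, -⟩ := h.exists_lift hi (conf_of_isIso_zero (isZero_zero A) (𝟙 Y) 0) a 0 (by simp)
  exact ⟨l, hl⟩

/-- No long exact sequence is needed: a section of an extension of M by Y is first chosen over X and
then extended along `i` by the lifting property. -/
theorem of_conf_left {X X' Y M : A} (h : E.ExtOneVanishes X Y) (h' : E.ExtOneVanishes X' Y)
    {i : X ⟶ M} {d : M ⟶ X'} (hM : E.Conf i d) : E.ExtOneVanishes M Y :=
  of_section fun {_ _ p} hp => by
    obtain ⟨a, ha⟩ := h.exists_lift_of_source hp i
    obtain ⟨s, -, hs⟩ := h'.exists_lift hM hp a (𝟙 M) (by simp [ha])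
    exact ⟨s, hs⟩

theorem of_conf_right {X Y Y' M : A} (h : E.ExtOneVanishes X Y) (h' : E.ExtOneVanishes X Y')
    {i : Y ⟶ M} {d : M ⟶ Y'} (hM : E.Conf i d) : E.ExtOneVanishes X M :=
  of_retraction fun {_ j _} hj => by
    obtain ⟨a, ha⟩ := h'.exists_extension hj d
    obtain ⟨s, hs, -⟩ := h.exists_lift hj hM (𝟙 M) a (by simp [ha])
    exact ⟨s, hs⟩

end ExtOneVanishes

theorem isDeflation_of_splitEpi (hA : WeaklyIdempotentComplete A) {X Y : A} {s : Y ⟶ X}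
    {d : X ⟶ Y} (h : s ≫ d = 𝟙 Y) : IsDeflation E.conflation d :=
  isDeflation_of_comp hA (f := s) (by rw [h]; exact isDeflation_of_isIso _)

theorem isInflation_of_splitMono (hA : WeaklyIdempotentComplete A) {X Y : A} {i : X ⟶ Y}
    {r : Y ⟶ X} (h : i ≫ r = 𝟙 X) : IsInflation E.conflation i :=
  isInflation_of_comp hA (f := r) (by rw [h]; exact isInflation_of_isIso _)

/-- The class of objects `P` is closed under extensions. -/
def ExtensionClosed (E : ExactStructure A) (P : ObjectProperty A) : Prop :=
  ∀ ⦃X Y Z : A⦄ ⦃i : X ⟶ Y⦄ ⦃d : Y ⟶ Z⦄, E.Conf i d → P X → P Z → P Y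

theorem IsCotorsionPair.extensionClosed_left {𝒳 𝒴 : ObjectProperty A} (h : E.IsCotorsionPair 𝒳 𝒴) :
    E.ExtensionClosed 𝒳 := fun _ _ _ _ _ hc h₁ h₃ =>
  (h.left _).2 fun F hF => ((h.left _).1 h₁ F hF).of_conf_left ((h.left _).1 h₃ F hF) hc

theorem IsCotorsionPair.extensionClosed_right {𝒳 𝒴 : ObjectProperty A}
    (h : E.IsCotorsionPair 𝒳 𝒴) : E.ExtensionClosed 𝒴 := fun _ _ _ _ _ hc h₁ h₃ =>
  (h.right _).2 fun F hF => ((h.right _).1 h₁ F hF).of_conf_right ((h.right _).1 h₃ F hF) hc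

theorem Conf.deflationsWithKernelIn {P : ObjectProperty A} {K X Y : A} {k : K ⟶ X} {d : X ⟶ Y}
    (h : E.Conf k d) (hK : P K) : E.deflationsWithKernelIn P d :=
  deflationsWithKernelIn_iff.2 ⟨_, _, h, hK⟩

/-! ### Calculus of deflations with kernel in a class. -/

section Deflations

variable {P : ObjectProperty A}

theorem deflationsWithKernelIn.isDeflation {X Y : A} {f : X ⟶ Y}
    (h : E.deflationsWithKernelIn P f) : IsDeflation E.conflation f := by
  obtain ⟨K, k, h, -⟩ := deflationsWithKernelIn_iff.1 h
  exact h.isDeflation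

theorem deflationsWithKernelIn.iso_comp {X Y Z : A} {f : Y ⟶ Z}
    (h : E.deflationsWithKernelIn P f) (e : X ≅ Y) :
    E.deflationsWithKernelIn P (e.hom ≫ f) := by
  obtain ⟨K, k, h, hK⟩ := deflationsWithKernelIn_iff.1 h
  exact (h.of_iso (Iso.refl _) e.symm (Iso.refl _) (i' := k ≫ e.inv) (by simp)
    (by simp)).deflationsWithKernelIn hK

theorem deflationsWithKernelIn_of_isIso (hP : IsAdditiveSummandClosed P) {X Y : A} (f : X ⟶ Y)
    [IsIso f] : E.deflationsWithKernelIn P f :=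
  (conf_zero_of_isIso (isZero_zero A) 0 f).deflationsWithKernelIn hP.zero

theorem deflationsWithKernelIn.comp (hP : E.ExtensionClosed P) {X Y Z : A} {f : X ⟶ Y} {g : Y ⟶ Z}
    (hf : E.deflationsWithKernelIn P f) (hg : E.deflationsWithKernelIn P g) :
    E.deflationsWithKernelIn P (f ≫ g) := by
  obtain ⟨K, k, hk, hK⟩ := deflationsWithKernelIn_iff.1 hf
  obtain ⟨L, l, hl, hL⟩ := deflationsWithKernelIn_iff.1 hg
  obtain ⟨_, _, _, _, h, h', -⟩ := hk.exists_comp hl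
  exact h.deflationsWithKernelIn (hP h' hK hL)

theorem deflationsWithKernelIn.fst_comp (hP : IsAdditiveSummandClosed P) {X Y W : A} {f : X ⟶ Y}
    (hf : E.deflationsWithKernelIn P f) (hW : P W) :
    E.deflationsWithKernelIn P (biprod.fst ≫ f : X ⊞ W ⟶ Y) := by
  obtain ⟨K, k, hk, hK⟩ := deflationsWithKernelIn_iff.1 hf
  exact (hk.biprod_map_id_fst W).deflationsWithKernelIn (hP.biprod hK hW)

theorem deflationsWithKernelIn.biprod_map_id {X Y : A} {f : X ⟶ Y}
    (hf : E.deflationsWithKernelIn P f) (W : A) :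
    E.deflationsWithKernelIn P (biprod.map f (𝟙 W)) := by
  obtain ⟨K, k, hk, hK⟩ := deflationsWithKernelIn_iff.1 hf
  exact (hk.biprod_map_id W).deflationsWithKernelIn hK

theorem deflationsWithKernelIn.id_biprod_map {X Y : A} {f : X ⟶ Y}
    (hf : E.deflationsWithKernelIn P f) (W : A) :
    E.deflationsWithKernelIn P (biprod.map (𝟙 W) f) := by
  obtain ⟨K, k, hk, hK⟩ := deflationsWithKernelIn_iff.1 hf
  exact (hk.id_biprod_map W).deflationsWithKernelIn hK

theorem deflationsWithKernelIn.desc_comp (hP : IsAdditiveSummandClosed P) {X Y W : A} {f : X ⟶ Y}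
    (hf : E.deflationsWithKernelIn P f) (hW : P W) (s : W ⟶ X) :
    E.deflationsWithKernelIn P (biprod.desc f (s ≫ f)) := by
  rw [← biprodShear_hom_fst_comp]
  exact (hf.fst_comp hP hW).iso_comp _

/-- Since `r ≫ f = g ≫ r'` is a deflation, so is `f` by cancellation, and its kernel is a retract of
that of `g`. -/
theorem deflationsWithKernelIn.of_retract (hA : WeaklyIdempotentComplete A)
    (hP : IsAdditiveSummandClosed P) {X Y X' Y' : A} {f : X ⟶ Y} {g : X' ⟶ Y'}
    (hg : E.deflationsWithKernelIn P g) {i : X ⟶ X'} {r : X' ⟶ X} {i' : Y ⟶ Y'} {r' : Y' ⟶ Y}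
    (hir : i ≫ r = 𝟙 X) (hir' : i' ≫ r' = 𝟙 Y) (hi : i ≫ g = f ≫ i') (hr : r ≫ f = g ≫ r') :
    E.deflationsWithKernelIn P f := by
  obtain ⟨L, l, hl, hL⟩ := deflationsWithKernelIn_iff.1 hg
  obtain ⟨K, k, hk⟩ := isDeflation_iff.1 (isDeflation_of_comp hA (f := r) (d := f) (by
    rw [hr]
    exact E.comp _ _ hl.isDeflation (isDeflation_of_splitEpi hA hir')))
  have hk : E.Conf k f := hk
  refine hk.deflationsWithKernelIn ?_
  obtain ⟨a, ha⟩ := hl.isKer.lift (k ≫ i) (by simp [hi, reassoc_of% hk.zero])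
  obtain ⟨b, hb⟩ := hk.isKer.lift (l ≫ r) (by simp [hr, reassoc_of% hl.zero])
  exact hP.of_retract hA (s := a) (r := b) (hk.isKer.ext (by simp [hb, reassoc_of% ha, hir])) hL

theorem deflationsWithKernelIn.of_fst_comp (hA : WeaklyIdempotentComplete A)
    (hP : IsAdditiveSummandClosed P) {X Y W : A} {f : X ⟶ Y}
    (hf : E.deflationsWithKernelIn P (biprod.fst ≫ f : X ⊞ W ⟶ Y)) :
    E.deflationsWithKernelIn P f :=
  hf.of_retract hA hP (i := biprod.inl) (r := biprod.fst) (i' := 𝟙 _) (r' := 𝟙 _) (by simp)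
    (by simp) (by simp) (by simp)

theorem deflationsWithKernelIn.of_desc_comp (hA : WeaklyIdempotentComplete A)
    (hP : IsAdditiveSummandClosed P) {X Y W : A} {f : X ⟶ Y} {s : W ⟶ X}
    (hf : E.deflationsWithKernelIn P (biprod.desc f (s ≫ f))) :
    E.deflationsWithKernelIn P f := by
  rw [← biprodShear_hom_fst_comp] at hf
  refine of_fst_comp hA hP (W := W) ?_
  simpa using hf.iso_comp (biprodShear s).symm

/-- If `f ≫ g` is a deflation, so is `(f, l)` for the kernel `l` of the deflation `g`, and both have
the same kernel. -/
theorem deflationsWithKernelIn.desc_isKer {X Y Z L : A} {f : X ⟶ Y} {g : Y ⟶ Z} {l : L ⟶ Y}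
    (h : E.deflationsWithKernelIn P (f ≫ g)) (hl : IsKer l g) :
    E.deflationsWithKernelIn P (biprod.desc f l) := by
  obtain ⟨K, k, hk, hK⟩ := deflationsWithKernelIn_iff.1 h
  -- X ⊕ L is the pullback of `f ≫ g` along `g`: the two maps to Y that agree in Z differ by a map
  -- to L.
  have sq : IsPullback biprod.fst (biprod.desc f l) (f ≫ g) g := by
    refine isPullback_of (by ext <;> simp [hl.zero]) (fun a b hab => ?_) (fun a h₁ h₂ => ?_)
    · obtain ⟨x, hx⟩ := hl.lift (b - a ≫ f) (by simp [hab])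
      exact ⟨biprod.lift a x, by simp, by simp [hx]⟩
    · have : a ≫ biprod.snd = 0 := hl.ext (by
        simpa [biprod.desc_eq, reassoc_of% h₁] using h₂)
      ext <;> simp [h₁, this]
  obtain ⟨k', hk', -⟩ := hk.of_isPullback sq
  exact hk'.deflationsWithKernelIn hK

end Deflations

end ExactStructure

theorem IsAdditiveSummandClosed.inf {P Q : ObjectProperty A} (hP : IsAdditiveSummandClosed P)
    (hQ : IsAdditiveSummandClosed Q) : IsAdditiveSummandClosed (P ⊓ Q) where
  of_iso e h := ⟨hP.of_iso e h.1, hQ.of_iso e h.2⟩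
  zero := ⟨hP.zero, hQ.zero⟩
  biprod h h' := ⟨hP.biprod h.1 h'.1, hQ.biprod h.2 h'.2⟩
  summand h := ⟨hP.summand h.1, hQ.summand h.2⟩

theorem splitMonosWithCokernelIn_iff (hA : WeaklyIdempotentComplete A) {P : ObjectProperty A}
    (hP : IsAdditiveSummandClosed P) {X Y : A} {f : X ⟶ Y} :
    splitMonosWithCokernelIn P f ↔
      ∃ (W : A) (e : X ⊞ W ≅ Y), biprod.inl ≫ e.hom = f ∧ P W := by
  have cok {W : A} (e : X ⊞ W ≅ Y) (he : biprod.inl ≫ e.hom = f) :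
      IsCok f (e.inv ≫ biprod.snd) := by
    refine ⟨by simp [← he], epi_comp _ _, fun g hg => ⟨biprod.inr ≫ e.hom ≫ g, ?_⟩⟩
    rw [← cancel_epi e.hom]
    ext
    · simp [reassoc_of% he, hg]
    · simp
  constructor
  · rintro ⟨⟨⟨s⟩⟩, C, c, w, ⟨h⟩, hC⟩
    obtain ⟨W, e, he, -⟩ := hA.exists_iso s.id
    obtain ⟨a, -⟩ := (IsCok.of_isColimit w h).exists_iso (cok e he)
    exact ⟨W, e, he, hP.of_iso a hC⟩
  · rintro ⟨W, e, he, hW⟩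
    exact ⟨⟨⟨⟨e.inv ≫ biprod.fst, by simp [← he]⟩⟩⟩, W, _, _, (cok e he).nonempty_isColimit, hW⟩

/-- The isomorphism which exchanges the last two summands. -/
noncomputable def biprodRightComm (X Y Z : A) : (X ⊞ Y) ⊞ Z ≅ (X ⊞ Z) ⊞ Y where
  hom := biprod.desc (biprod.desc (biprod.inl ≫ biprod.inl) biprod.inr) (biprod.inr ≫ biprod.inl)
  inv := biprod.desc (biprod.desc (biprod.inl ≫ biprod.inl) biprod.inr) (biprod.inr ≫ biprod.inl)
  hom_inv_id := by ext <;> simp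
  inv_hom_id := by ext <;> simp

/-- The associativity isomorphism, in terms of the maps out of a biproduct. -/
noncomputable def biprodAssoc (X Y Z : A) : X ⊞ (Y ⊞ Z) ≅ (X ⊞ Y) ⊞ Z where
  hom := biprod.desc (biprod.inl ≫ biprod.inl) (biprod.map biprod.inr (𝟙 Z))
  inv := biprod.desc (biprod.map (𝟙 X) biprod.inl) (biprod.inr ≫ biprod.inr)
  hom_inv_id := by ext <;> simp
  inv_hom_id := by ext <;> simp

/-! ### The three classes and the trivial (co)fibrations. -/

variable {E : ExactStructure A} {𝒳 𝒴 : ObjectProperty A}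

open ExactStructure

theorem fibω_iff {X Y : A} {f : X ⟶ Y} :
    Fibω 𝒳 𝒴 f ↔ ∀ (W : A) (g : W ⟶ Y), (𝒳 ⊓ 𝒴) W → ∃ h : W ⟶ X, h ≫ f = g :=
  ⟨fun h W g hW => h W hW g, fun h W hW g => h W g hW⟩

theorem coFibω_iff {X Y : A} {f : X ⟶ Y} :
    CoFibω E 𝒳 f ↔ ∃ (C : A) (c : Y ⟶ C), E.Conf f c ∧ 𝒳 C :=
  inflationsWithCokernelIn_iff

theorem weqω_of_deflationsWithKernelIn (h𝒳 : IsAdditiveSummandClosed 𝒳)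
    (h𝒴 : IsAdditiveSummandClosed 𝒴) {X Y : A} {f : X ⟶ Y} (h : E.deflationsWithKernelIn 𝒴 f) :
    Weqω E 𝒳 𝒴 f :=
  ⟨0, 0, ⟨h𝒳.zero, h𝒴.zero⟩, by simpa using h.desc_comp h𝒴 h𝒴.zero (0 : 0 ⟶ X)⟩

theorem weqω_of_splitMonosWithCokernelIn (hA : WeaklyIdempotentComplete A)
    (h𝒳 : IsAdditiveSummandClosed 𝒳) (h𝒴 : IsAdditiveSummandClosed 𝒴) {X Y : A} {f : X ⟶ Y}
    (h : splitMonosWithCokernelIn (𝒳 ⊓ 𝒴) f) : Weqω E 𝒳 𝒴 f := by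
  obtain ⟨W, e, he, hW⟩ := (splitMonosWithCokernelIn_iff hA (h𝒳.inf h𝒴)).1 h
  refine ⟨W, biprod.inr ≫ e.hom, hW, ?_⟩
  have : biprod.desc f (biprod.inr ≫ e.hom) = e.hom := by ext <;> simp [he]
  rw [this]
  exact deflationsWithKernelIn_of_isIso h𝒴 _

theorem coFibω_of_splitMonosWithCokernelIn (hA : WeaklyIdempotentComplete A)
    (h𝒳 : IsAdditiveSummandClosed 𝒳) (h𝒴 : IsAdditiveSummandClosed 𝒴) {X Y : A} {f : X ⟶ Y}
    (h : splitMonosWithCokernelIn (𝒳 ⊓ 𝒴) f) : CoFibω E 𝒳 f := by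
  obtain ⟨W, e, he, hW⟩ := (splitMonosWithCokernelIn_iff hA (h𝒳.inf h𝒴)).1 h
  exact coFibω_iff.2 ⟨W, e.inv ≫ biprod.snd,
    (conf_inl_snd X W).of_iso (Iso.refl _) e (Iso.refl _) (by simp [he]) (by simp), hW.1⟩

/-- The fibration property lifts the extra component t through `f`, and a shear then removes it. No
Ext¹-vanishing is required, so this is available before the cotorsion pair is known. -/
theorem deflationsWithKernelIn_of_fibω_of_weqω (hA : WeaklyIdempotentComplete A)
    (h𝒴 : IsAdditiveSummandClosed 𝒴) {X Y : A} {f : X ⟶ Y} (h : Fibω 𝒳 𝒴 f)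
    (h' : Weqω E 𝒳 𝒴 f) : E.deflationsWithKernelIn 𝒴 f := by
  obtain ⟨W, t, hW, h'⟩ := h'
  obtain ⟨s, rfl⟩ := fibω_iff.1 h W t hW
  exact h'.of_desc_comp hA h𝒴

theorem weqω_biprod_inl (hA : WeaklyIdempotentComplete A)
    (h𝒳 : IsAdditiveSummandClosed 𝒳) (h𝒴 : IsAdditiveSummandClosed 𝒴) {W : A} (X : A)
    (hW : (𝒳 ⊓ 𝒴) W) : Weqω E 𝒳 𝒴 (biprod.inl : X ⟶ X ⊞ W) :=
  weqω_of_splitMonosWithCokernelIn hA h𝒳 h𝒴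
    ((splitMonosWithCokernelIn_iff hA (h𝒳.inf h𝒴)).2 ⟨W, Iso.refl _, by simp, hW⟩)

theorem exists_lift_of_ext
    (hext : ∀ X Y : A, 𝒳 X → 𝒴 Y → E.ExtOneVanishes X Y)
    {X Y B C : A} {i : X ⟶ Y} {p : B ⟶ C} (hi : CoFibω E 𝒳 i)
    (hp : E.deflationsWithKernelIn 𝒴 p) (a : X ⟶ B) (b : Y ⟶ C) (w : a ≫ p = i ≫ b) :
    ∃ l : Y ⟶ B, i ≫ l = a ∧ l ≫ p = b := by
  obtain ⟨K, c, hi, hX⟩ := coFibω_iff.1 hi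
  obtain ⟨L, k, hp, hY⟩ := deflationsWithKernelIn_iff.1 hp
  exact (hext _ _ hX hY).exists_lift hi hp a b w

theorem exists_lift_of_source_of_ext
    (hext : ∀ X Y : A, 𝒳 X → 𝒴 Y → E.ExtOneVanishes X Y)
    {X B C : A} {p : B ⟶ C} (hX : 𝒳 X)
    (hp : E.deflationsWithKernelIn 𝒴 p) (b : X ⟶ C) : ∃ l : X ⟶ B, l ≫ p = b := by
  obtain ⟨L, k, hp, hY⟩ := deflationsWithKernelIn_iff.1 hp
  exact (hext _ _ hX hY).exists_lift_of_source hp b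

theorem fibω_of_deflationsWithKernelIn
    (hext : ∀ X Y : A, 𝒳 X → 𝒴 Y → E.ExtOneVanishes X Y)
    {X Y : A} {f : X ⟶ Y} (h : E.deflationsWithKernelIn 𝒴 f) :
    Fibω 𝒳 𝒴 f :=
  fibω_iff.2 fun _ g hW => exists_lift_of_source_of_ext hext hW.1 h g

theorem fibω_inf_weqω
    (hext : ∀ X Y : A, 𝒳 X → 𝒴 Y → E.ExtOneVanishes X Y)
    (hA : WeaklyIdempotentComplete A) (h𝒳 : IsAdditiveSummandClosed 𝒳)
    (h𝒴 : IsAdditiveSummandClosed 𝒴) :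
    Fibω 𝒳 𝒴 ⊓ Weqω E 𝒳 𝒴 = E.deflationsWithKernelIn 𝒴 := by
  ext X Y f
  exact ⟨fun h => deflationsWithKernelIn_of_fibω_of_weqω hA h𝒴 h.1 h.2, fun h =>
    ⟨fibω_of_deflationsWithKernelIn hext h, weqω_of_deflationsWithKernelIn h𝒳 h𝒴 h⟩⟩

theorem coFibω_inf_weqω
    (hext : ∀ X Y : A, 𝒳 X → 𝒴 Y → E.ExtOneVanishes X Y)
    (hA : WeaklyIdempotentComplete A) (h𝒳 : IsAdditiveSummandClosed 𝒳)
    (h𝒴 : IsAdditiveSummandClosed 𝒴) :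
    CoFibω E 𝒳 ⊓ Weqω E 𝒳 𝒴 = splitMonosWithCokernelIn (𝒳 ⊓ 𝒴) := by
  ext X Y f
  refine ⟨fun ⟨h, h'⟩ => ?_, fun h => ⟨coFibω_of_splitMonosWithCokernelIn hA h𝒳 h𝒴 h,
    weqω_of_splitMonosWithCokernelIn hA h𝒳 h𝒴 h⟩⟩
  obtain ⟨W, t, hW, h'⟩ := h'
  -- The first component of this lift is a retraction of `f`. On the complement K it vanishes, so
  -- the second component followed by `t` is the identity modulo X, and K is a retract of W.
  obtain ⟨s, hs, hs'⟩ := exists_lift_of_ext hext h h' biprod.inl (𝟙 Y) (by simp)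
  obtain ⟨K, e, he, he'⟩ := hA.exists_iso (s := f) (r := s ≫ biprod.fst) (by simp [reassoc_of% hs])
  refine (splitMonosWithCokernelIn_iff hA (h𝒳.inf h𝒴)).2 ⟨K, e, he, ?_⟩
  refine (h𝒳.inf h𝒴).of_retract hA (s := biprod.inr ≫ e.hom ≫ s ≫ biprod.snd)
    (r := t ≫ e.inv ≫ biprod.snd) ?_ hW
  have h₁ : s ≫ biprod.snd ≫ t = 𝟙 Y - s ≫ biprod.fst ≫ f := by
    rw [eq_sub_iff_add_eq', ← hs', biprod.desc_eq, Preadditive.comp_add]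
  simp only [Category.assoc, reassoc_of% h₁]
  simp [← he]

/-- A further map from an object of `𝒳 ⊓ 𝒴` may be added to a deflation with kernel in `𝒴`. -/
theorem desc_mem_deflationsWithKernelIn (h𝒴 : IsAdditiveSummandClosed 𝒴)
    (hext : ∀ X Y : A, 𝒳 X → 𝒴 Y → E.ExtOneVanishes X Y) {X Y V : A} {f : X ⟶ Y}
    (h : E.deflationsWithKernelIn 𝒴 f) (hV : (𝒳 ⊓ 𝒴) V) (s : V ⟶ Y) :
    E.deflationsWithKernelIn 𝒴 (biprod.desc f s) := by
  obtain ⟨σ, rfl⟩ := exists_lift_of_source_of_ext hext hV.1 h s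
  exact h.desc_comp h𝒴 hV.2 σ

theorem ext_of_isCotorsionPair (h : E.IsCotorsionPair 𝒳 𝒴) (X Y : A) (hX : 𝒳 X) (hY : 𝒴 Y) :
    E.ExtOneVanishes X Y := (h.left X).1 hX Y hY

/-! ### Retracts and two out of three for weak equivalences. -/

/-- Weak equivalences are stable under retracts. -/
theorem weqω_of_retract (hA : WeaklyIdempotentComplete A) (h𝒴 : IsAdditiveSummandClosed 𝒴)
    (hext : ∀ X Y : A, 𝒳 X → 𝒴 Y → E.ExtOneVanishes X Y)
    (hω : ContravariantlyFinite (𝒳 ⊓ 𝒴)) {X Y X' Y' : A} {f : X ⟶ Y} {g : X' ⟶ Y'}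
    (hg : Weqω E 𝒳 𝒴 g) {i : X ⟶ X'} {r : X' ⟶ X} {i' : Y ⟶ Y'} {r' : Y' ⟶ Y}
    (hir : i ≫ r = 𝟙 X) (hir' : i' ≫ r' = 𝟙 Y) (hi : i ≫ g = f ≫ i') (hr : r ≫ f = g ≫ r') :
    Weqω E 𝒳 𝒴 f := by
  obtain ⟨W, t, hW, hg⟩ := hg
  -- The object W attached to `g` need not fit in a retract diagram over Y, so the approximation of
  -- Y is used on both sides: (f, t₀) is a retract of (g, t, t₀ ≫ i'), where `σ` carries the summand
  -- W to W₀.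
  obtain ⟨W₀, t₀, hW₀, ht₀⟩ := hω Y
  obtain ⟨σ, hσ⟩ := ht₀ W (t ≫ r') hW
  refine ⟨W₀, t₀, hW₀, (desc_mem_deflationsWithKernelIn h𝒴 hext hg hW₀ (t₀ ≫ i')).of_retract hA h𝒴
    (i := biprod.map (i ≫ biprod.inl) (𝟙 W₀))
    (r := biprod.desc (biprod.desc (r ≫ biprod.inl) (σ ≫ biprod.inr)) biprod.inr)
    (i' := i') (r' := r') ?_ hir' ?_ ?_⟩
  · ext <;> simp [reassoc_of% hir]
  · ext <;> simp [hi]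
  · ext <;> simp [hr, hσ, hir']

theorem weqω_comp (h𝒳 : IsAdditiveSummandClosed 𝒳) (h𝒴 : IsAdditiveSummandClosed 𝒴)
    (h : E.ExtensionClosed 𝒴) {X Y Z : A} {f : X ⟶ Y} {g : Y ⟶ Z} (hf : Weqω E 𝒳 𝒴 f)
    (hg : Weqω E 𝒳 𝒴 g) : Weqω E 𝒳 𝒴 (f ≫ g) := by
  obtain ⟨W, t, hW, hf⟩ := hf
  obtain ⟨V, s, hV, hg⟩ := hg
  refine ⟨W ⊞ V, biprod.desc (t ≫ g) s, (h𝒳.inf h𝒴).biprod hW hV, ?_⟩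
  have := ((hf.biprod_map_id V).comp h hg).iso_comp (biprodAssoc X W V)
  convert this using 1
  ext <;> simp [biprodAssoc]

/-- The kernels of `f`, `f ≫ g` and `g` form a conflation, so closure of `𝒴` under cokernels of
inflations applies. -/
theorem deflationsWithKernelIn.of_precomp (hA : WeaklyIdempotentComplete A)
    (h𝒴 : IsAdditiveSummandClosed 𝒴)
    (hc : ∀ S : ShortComplex A, E.conflation S → 𝒴 S.X₁ → 𝒴 S.X₂ → 𝒴 S.X₃)
    {X Y Z : A} {f : X ⟶ Y} {g : Y ⟶ Z} (hf : E.deflationsWithKernelIn 𝒴 f)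
    (hfg : E.deflationsWithKernelIn 𝒴 (f ≫ g)) : E.deflationsWithKernelIn 𝒴 g := by
  obtain ⟨L, l, hl⟩ := isDeflation_iff.1 (isDeflation_of_comp hA hfg.isDeflation)
  obtain ⟨K, k, hk, hK⟩ := deflationsWithKernelIn_iff.1 hf
  obtain ⟨M, m, hm, hM⟩ := deflationsWithKernelIn_iff.1 hfg
  obtain ⟨P, m', k', d', h₁, ⟨w, h₂⟩, -, -⟩ := hk.exists_comp hl
  obtain ⟨e, -⟩ := hm.isKer.exists_iso h₁.isKer
  exact Conf.deflationsWithKernelIn hl (hc _ h₂ hK (h𝒴.of_iso e hM))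

theorem weqω_of_precomp (hA : WeaklyIdempotentComplete A) (h𝒴 : IsAdditiveSummandClosed 𝒴)
    (hext : ∀ X Y : A, 𝒳 X → 𝒴 Y → E.ExtOneVanishes X Y)
    (hc : ∀ S : ShortComplex A, E.conflation S → 𝒴 S.X₁ → 𝒴 S.X₂ → 𝒴 S.X₃)
    {X Y Z : A} {f : X ⟶ Y} {g : Y ⟶ Z} (hf : Weqω E 𝒳 𝒴 f)
    (hfg : Weqω E 𝒳 𝒴 (f ≫ g)) : Weqω E 𝒳 𝒴 g := by
  obtain ⟨W, t, hW, hf⟩ := hf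
  obtain ⟨V, s, hV, hfg⟩ := hfg
  refine ⟨V, s, hV, deflationsWithKernelIn.of_precomp hA h𝒴 hc (hf.biprod_map_id V) ?_⟩
  have := (desc_mem_deflationsWithKernelIn h𝒴 hext hfg hW (t ≫ g)).iso_comp (biprodRightComm X W V)
  convert this using 1
  ext <;> simp [biprodRightComm]

/-- With l : L → Y the kernel of `g`, the deflation (f, l) has the same kernel as `f ≫ g`, but L
lies only in `𝒴`. A cover C of L is in `𝒳`, and in `𝒴` as an extension of members of `𝒴`; so C is in
ω and can replace L. -/
theorem weqω_of_deflations
    (h : E.IsCompleteCotorsionPair 𝒳 𝒴) {X Y Z : A} {f : X ⟶ Y} {g : Y ⟶ Z}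
    (hg : E.deflationsWithKernelIn 𝒴 g) (hfg : E.deflationsWithKernelIn 𝒴 (f ≫ g)) :
    Weqω E 𝒳 𝒴 f := by
  obtain ⟨L, l, hl, hL⟩ := deflationsWithKernelIn_iff.1 hg
  obtain ⟨F, C, i, d, w, hi, hC, hF⟩ := h.cover L
  have hi : E.Conf i d := ⟨w, hi⟩
  refine ⟨C, d ≫ l, ⟨hC, h.extensionClosed_right hi hF hL⟩, ?_⟩
  have := ((hi.deflationsWithKernelIn hF).id_biprod_map X).comp h.extensionClosed_right
    (hfg.desc_isKer hl.isKer)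
  convert this using 1
  ext <;> simp

/-- Adding W ⊕ V to X and Y makes both `g` and the composite deflations with kernel in `𝒴`. This
treats f ⊕ 1, of which `f` is a retract. -/
theorem weqω_of_postcomp (hA : WeaklyIdempotentComplete A) (h𝒴 : IsAdditiveSummandClosed 𝒴) (h : E.IsCompleteCotorsionPair 𝒳 𝒴)
    (hω : ContravariantlyFinite (𝒳 ⊓ 𝒴))
    {X Y Z : A} {f : X ⟶ Y} {g : Y ⟶ Z} (hg : Weqω E 𝒳 𝒴 g)
    (hfg : Weqω E 𝒳 𝒴 (f ≫ g)) : Weqω E 𝒳 𝒴 f := by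
  have hext := ext_of_isCotorsionPair h.toIsCotorsionPair
  obtain ⟨W, t, hW, hg⟩ := hg
  obtain ⟨V, s, hV, hfg⟩ := hfg
  have hg' := (desc_mem_deflationsWithKernelIn h𝒴 hext hg hV s).iso_comp (biprodAssoc _ _ _)
  have hfg' := ((desc_mem_deflationsWithKernelIn h𝒴 hext hfg hW t).iso_comp (biprodRightComm _ _ _)).iso_comp
    (biprodAssoc _ _ _)
  refine weqω_of_retract hA h𝒴 hext hω (g := biprod.map f (𝟙 (W ⊞ V)))
    (weqω_of_deflations h hg' ?_) (i := biprod.inl) (r := biprod.fst)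
    (i' := biprod.inl) (r' := biprod.fst) (by simp) (by simp) (by simp) (by simp)
  convert hfg' using 1
  ext <;> simp [biprodRightComm, biprodAssoc]

/-! ### Cofibrations, factorization and the model structure. -/

theorem coFibω_of_retract (hA : WeaklyIdempotentComplete A) (h𝒳 : IsAdditiveSummandClosed 𝒳)
    {X Y X' Y' : A} {f : X ⟶ Y} {g : X' ⟶ Y'}
    (hg : CoFibω E 𝒳 g) {i : X ⟶ X'} {r : X' ⟶ X} {i' : Y ⟶ Y'} {r' : Y' ⟶ Y}
    (hir : i ≫ r = 𝟙 X) (hir' : i' ≫ r' = 𝟙 Y) (hi : i ≫ g = f ≫ i') (hr : r ≫ f = g ≫ r') :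
    CoFibω E 𝒳 f := by
  obtain ⟨C, c, hc, hC⟩ := coFibω_iff.1 hg
  obtain ⟨D, d, hd⟩ := isInflation_iff.1 (isInflation_of_comp hA (i := f) (f := i') (by
    rw [← hi]
    exact isInflation_comp (isInflation_of_splitMono hA hir) hc.isInflation))
  have hd : E.Conf f d := hd
  obtain ⟨a, ha⟩ := hd.isCok.desc (i' ≫ c) (by simp [← reassoc_of% hi, hc.zero])
  obtain ⟨b, hb⟩ := hc.isCok.desc (r' ≫ d) (by simp [← reassoc_of% hr, hd.zero])
  exact coFibω_iff.2 ⟨D, d, hd, h𝒳.of_retract hA (s := a) (r := b)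
    (hd.isCok.ext (by simp [reassoc_of% ha, hb, reassoc_of% hir'])) hC⟩

/-- For a cover d : C → Y the map (f, d) : X ⊕ C → Y is a deflation. Pushing out along an envelope
of its kernel replaces that kernel by a member of `𝒴`, and X → X ⊕ C → Z has as cokernel an
extension of two members of `𝒳`. -/
theorem exists_factorization (h : E.IsCompleteCotorsionPair 𝒳 𝒴) {X Y : A} (f : X ⟶ Y) :
    ∃ (Z : A) (j : X ⟶ Z) (q : Z ⟶ Y), j ≫ q = f ∧ CoFibω E 𝒳 j ∧
      E.deflationsWithKernelIn 𝒴 q := by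
  obtain ⟨F, C, i, d, w, hi, hC, hF⟩ := h.cover Y
  have hi : E.Conf i d := ⟨w, hi⟩
  obtain ⟨K, k, hk⟩ := isDeflation_iff.1 (isDeflation_desc hi.isDeflation f)
  have hk : E.Conf (k ≫ (biprod.braiding _ _).hom) (biprod.desc f d) :=
    Conf.of_iso hk (Iso.refl _) (biprod.braiding _ _) (Iso.refl _) (by simp) (by ext <;> simp)
  obtain ⟨F', C', i', d', w', hi', hC', hF'⟩ := h.envelope K
  have hi' : E.Conf i' d' := ⟨w', hi'⟩
  obtain ⟨Z, a, b, q, sq, hq, haq⟩ := hk.exists_pushout i'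
  obtain ⟨c, hc, -⟩ := hi'.of_isPushout sq.flip
  obtain ⟨P, m, j', d'', h₁, h₂, -, -⟩ := (conf_inl_snd X C).exists_comp_inflation hc
  exact ⟨Z, biprod.inl ≫ a, q, by simp [haq], coFibω_iff.2 ⟨P, m, h₁,
    h.extensionClosed_left h₂ hC hC'⟩, hq.deflationsWithKernelIn hF'⟩

theorem isModelStructure (hA : WeaklyIdempotentComplete A) (h𝒳 : IsAdditiveSummandClosed 𝒳)
    (h𝒴 : IsAdditiveSummandClosed 𝒴) (h : E.IsHereditaryCompleteCotorsionPair 𝒳 𝒴)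
    (hω : ContravariantlyFinite (𝒳 ⊓ 𝒴)) :
    IsModelStructure (CoFibω E 𝒳) (Fibω 𝒳 𝒴) (Weqω E 𝒳 𝒴) := by
  have hext := ext_of_isCotorsionPair h.toIsCotorsionPair
  exact
  { two_out_of_three :=
      { comp_mem _ _ hf hg := weqω_comp h𝒳 h𝒴 h.extensionClosed_right hf hg
        of_postcomp _ _ hg hfg := weqω_of_postcomp hA h𝒴 h.toIsCompleteCotorsionPair hω hg hfg
        of_precomp _ _ hf hfg := weqω_of_precomp hA h𝒴 hext h.cokernel_mem hf hfg }
    retract_cof := ⟨fun r hg => coFibω_of_retract hA h𝒳 hg r.retract_left r.retract_right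
      r.i_w r.r_w⟩
    retract_fib := ⟨fun {X Y X' Y' f g} r hg => fibω_iff.2 fun W b hW => by
      obtain ⟨l, hl⟩ := fibω_iff.1 hg W (b ≫ r.i.right) hW
      refine ⟨l ≫ r.r.left, ?_⟩
      rw [Category.assoc, r.r_w, reassoc_of% hl, r.retract_right, Category.comp_id]⟩
    retract_weq := ⟨fun r hg => weqω_of_retract hA h𝒴 hext hω hg r.retract_left r.retract_right
      r.i_w r.r_w⟩
    lift_trivial_fib i p hi hp hp' := ⟨fun {a b} sq => by
      obtain ⟨l, h₁, h₂⟩ := exists_lift_of_ext hext hi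
        (deflationsWithKernelIn_of_fibω_of_weqω hA h𝒴 hp hp') a b sq.w
      exact ⟨⟨⟨l, h₁, h₂⟩⟩⟩⟩
    lift_trivial_cof i p hi hi' hp := ⟨fun {a b} sq => by
      obtain ⟨W, e, rfl, hW⟩ := (splitMonosWithCokernelIn_iff hA (h𝒳.inf h𝒴)).1
        (coFibω_inf_weqω hext hA h𝒳 h𝒴 ▸ ⟨hi, hi'⟩ : splitMonosWithCokernelIn (𝒳 ⊓ 𝒴) i)
      obtain ⟨l, hl⟩ := fibω_iff.1 hp W (biprod.inr ≫ e.hom ≫ b) hW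
      refine ⟨⟨⟨e.inv ≫ biprod.desc a l, by simp, ?_⟩⟩⟩
      rw [← cancel_epi e.hom]
      ext
      · simpa using sq.w
      · simp [hl]⟩
    fac_trivial_cof {X Y} f := by
      obtain ⟨W, t, hW, ht⟩ := hω Y
      have : splitMonosWithCokernelIn (𝒳 ⊓ 𝒴) (biprod.inl : X ⟶ X ⊞ W) :=
        (splitMonosWithCokernelIn_iff hA (h𝒳.inf h𝒴)).2 ⟨W, Iso.refl _, by simp, hW⟩
      refine ⟨X ⊞ W, biprod.inl, biprod.desc f t, by simp,
        coFibω_of_splitMonosWithCokernelIn hA h𝒳 h𝒴 this,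
        weqω_of_splitMonosWithCokernelIn hA h𝒳 h𝒴 this, fibω_iff.2 fun V g hV => ?_⟩
      obtain ⟨l, hl⟩ := ht V g hV
      exact ⟨l ≫ biprod.inr, by simp [hl]⟩
    fac_trivial_fib f := by
      obtain ⟨Z, j, q, hf, hj, hq⟩ := exists_factorization h.toIsCompleteCotorsionPair f
      exact ⟨Z, j, q, hf, hj, fibω_of_deflationsWithKernelIn hext hq,
        weqω_of_deflationsWithKernelIn h𝒳 h𝒴 hq⟩ }

/-! ### From the model structure to the cotorsion pair. -/

theorem coFibω_zero_iff (h𝒳 : IsAdditiveSummandClosed 𝒳) {Z : A} :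
    CoFibω E 𝒳 (0 : (0 : A) ⟶ Z) ↔ 𝒳 Z := by
  have hZ : E.Conf (0 : (0 : A) ⟶ Z) (𝟙 Z) := conf_zero_of_isIso (isZero_zero A) _ _
  rw [coFibω_iff]
  constructor
  · rintro ⟨C, c, h, hC⟩
    obtain ⟨e, -⟩ := h.isCok.exists_iso hZ.isCok
    exact h𝒳.of_iso e hC
  · exact fun h => ⟨Z, 𝟙 Z, hZ, h⟩

theorem deflationsWithKernelIn_zero_iff (h𝒴 : IsAdditiveSummandClosed 𝒴) {Z : A} :
    E.deflationsWithKernelIn 𝒴 (0 : Z ⟶ (0 : A)) ↔ 𝒴 Z := by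
  have hZ : E.Conf (𝟙 Z) (0 : Z ⟶ (0 : A)) := conf_of_isIso_zero (isZero_zero A) _ _
  constructor
  · intro h
    obtain ⟨C, c, h, hC⟩ := deflationsWithKernelIn_iff.1 h
    obtain ⟨e, -⟩ := h.isKer.exists_iso hZ.isKer
    exact h𝒴.of_iso e hC
  · exact fun h => hZ.deflationsWithKernelIn h

theorem fibω_zero (Z : A) : Fibω 𝒳 𝒴 (0 : Z ⟶ (0 : A)) :=
  fibω_iff.2 fun W g _ => ⟨0, by ext⟩

/-- In an extension of X by Y the inflation is a cofibration and Y → 0 a trivial fibration; lifting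
the identity of Y splits it. -/
theorem ext_of_isModelStructure (h𝒳 : IsAdditiveSummandClosed 𝒳) (h𝒴 : IsAdditiveSummandClosed 𝒴)
    (hM : IsModelStructure (CoFibω E 𝒳) (Fibω 𝒳 𝒴) (Weqω E 𝒳 𝒴)) (X Y : A) (hX : 𝒳 X)
    (hY : 𝒴 Y) : E.ExtOneVanishes X Y :=
  .of_retraction fun {M i d} hc => by
    have := hM.lift_trivial_fib i (0 : Y ⟶ (0 : A)) (coFibω_iff.2 ⟨X, d, hc, hX⟩) (fibω_zero Y)
      (weqω_of_deflationsWithKernelIn h𝒳 h𝒴 ((deflationsWithKernelIn_zero_iff h𝒴).2 hY))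
    have sq : CommSq (𝟙 Y) i (0 : Y ⟶ (0 : A)) 0 := ⟨by ext⟩
    exact ⟨sq.lift, sq.fac_left⟩

/-- Covers and envelopes come from factoring 0 → X and X → 0 into a cofibration and a trivial
fibration. An object orthogonal to one class splits its own cover or envelope, hence is a retract of
a member of the other class. -/
theorem isCompleteCotorsionPair_of_isModelStructure (hA : WeaklyIdempotentComplete A)
    (h𝒳 : IsAdditiveSummandClosed 𝒳) (h𝒴 : IsAdditiveSummandClosed 𝒴)
    (hM : IsModelStructure (CoFibω E 𝒳) (Fibω 𝒳 𝒴) (Weqω E 𝒳 𝒴)) :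
    E.IsCompleteCotorsionPair 𝒳 𝒴 := by
  have hext := ext_of_isModelStructure h𝒳 h𝒴 hM
  have cover (X : A) : ∃ (F C : A) (i : F ⟶ C) (d : C ⟶ X), E.Conf i d ∧ 𝒳 C ∧ 𝒴 F := by
    obtain ⟨C, j, q, -, hj, hq, hq'⟩ := hM.fac_trivial_fib (0 : (0 : A) ⟶ X)
    obtain ⟨F, i, hi, hF⟩ := deflationsWithKernelIn_iff.1
      (deflationsWithKernelIn_of_fibω_of_weqω hA h𝒴 hq hq')
    obtain rfl : j = 0 := by ext
    exact ⟨F, C, i, q, hi, (coFibω_zero_iff h𝒳).1 hj, hF⟩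
  have envelope (X : A) : ∃ (F C : A) (i : X ⟶ F) (d : F ⟶ C), E.Conf i d ∧ 𝒳 C ∧ 𝒴 F := by
    obtain ⟨F, j, q, -, hj, hq, hq'⟩ := hM.fac_trivial_fib (0 : X ⟶ (0 : A))
    obtain ⟨C, d, hj, hC⟩ := coFibω_iff.1 hj
    obtain rfl : q = 0 := by ext
    exact ⟨F, C, j, d, hj, hC, (deflationsWithKernelIn_zero_iff h𝒴).1
      (deflationsWithKernelIn_of_fibω_of_weqω hA h𝒴 hq hq')⟩
  exact
  { left X := by
      refine ⟨fun hX F hF => hext X F hX hF, fun h => ?_⟩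
      obtain ⟨F, C, i, d, hc, hC, hF⟩ := cover X
      obtain ⟨s, hs⟩ := (h F hF).exists_section hc
      exact h𝒳.of_retract hA hs hC
    right Y := by
      refine ⟨fun hY C hC => hext C Y hC hY, fun h => ?_⟩
      obtain ⟨F, C, i, d, hc, hC, hF⟩ := envelope Y
      obtain ⟨r, hr⟩ := (h C hC).exists_retraction hc
      exact h𝒴.of_retract hA hr hF
    cover X := by
      obtain ⟨F, C, i, d, ⟨w, hc⟩, hC, hF⟩ := cover X
      exact ⟨F, C, i, d, w, hc, hC, hF⟩
    envelope X := by
      obtain ⟨F, C, i, d, ⟨w, hc⟩, hC, hF⟩ := envelope X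
      exact ⟨F, C, i, d, w, hc, hC, hF⟩ }

/-- For a complete cotorsion pair, closure of the right class under cokernels of inflations implies
closure of the left class under kernels of deflations. -/
theorem ExactStructure.IsCompleteCotorsionPair.kernel_mem (hA : WeaklyIdempotentComplete A)
    (h𝒳 : IsAdditiveSummandClosed 𝒳) (h : E.IsCompleteCotorsionPair 𝒳 𝒴)
    (hc : ∀ S : ShortComplex A, E.conflation S → 𝒴 S.X₁ → 𝒴 S.X₂ → 𝒴 S.X₃)
    {K X Z : A} {f : K ⟶ X} {g : X ⟶ Z} (hfg : E.Conf f g) (hX : 𝒳 X) (hZ : 𝒳 Z) : 𝒳 K := by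
  have hext := ext_of_isCotorsionPair h.toIsCotorsionPair
  -- The aim is to split this cover of K, which makes K a retract of C. The cokernel Q of F → C → F'
  -- below is in `𝒴` by hypothesis.
  obtain ⟨F, C, i, d, w, hi, hC, hF⟩ := h.cover K
  have hi : E.Conf i d := ⟨w, hi⟩
  obtain ⟨F', C', j, d', w', hj, -, hF'⟩ := h.envelope C
  have hj : E.Conf j d' := ⟨w', hj⟩
  obtain ⟨Q, q, hq⟩ := isInflation_iff.1 (isInflation_comp hi.isInflation hj.isInflation)
  have hQ : 𝒴 Q := by
    obtain ⟨w'', hq⟩ := hq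
    exact hc _ hq hF hF'
  obtain ⟨κ, hκ⟩ := hi.isCok.desc (j ≫ q) (by simpa using hq.zero)
  -- The map K → Q extends to X, then lifts to F' because Ext¹(X, F) = 0. Subtracting the result
  -- from `j` gives a map that dies in Q, hence lands in F and retracts `i`.
  obtain ⟨κ', hκ'⟩ := (hext Z Q hZ hQ).exists_extension hfg κ
  obtain ⟨l, hl⟩ := (hext X F hX hF).exists_lift_of_source hq κ'
  obtain ⟨r, hr⟩ := hq.isKer.lift (j - d ≫ f ≫ l) (by simp [hl, hκ', hκ])
  have hir : i ≫ r = 𝟙 F := hq.isKer.ext (by simp [hr, reassoc_of% hi.zero])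
  obtain ⟨s, hs⟩ := hi.isCok.desc (𝟙 C - r ≫ i) (by simp [reassoc_of% hir])
  exact h𝒳.of_retract hA (s := s) (r := d)
    (hi.isCok.ext (by simp [reassoc_of% hs, hi.zero])) hC

/-- A deflation with kernel in `𝒴` is a weak equivalence, so two out of three passes triviality from
the middle term to the cokernel. -/
theorem isHereditaryCompleteCotorsionPair_of_isModelStructure (hA : WeaklyIdempotentComplete A)
    (h𝒳 : IsAdditiveSummandClosed 𝒳) (h𝒴 : IsAdditiveSummandClosed 𝒴)
    (hM : IsModelStructure (CoFibω E 𝒳) (Fibω 𝒳 𝒴) (Weqω E 𝒳 𝒴)) :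
    E.IsHereditaryCompleteCotorsionPair 𝒳 𝒴 := by
  have h := isCompleteCotorsionPair_of_isModelStructure hA h𝒳 h𝒴 hM
  have := hM.two_out_of_three
  have hc (S : ShortComplex A) (hS : E.conflation S) (h₁ : 𝒴 S.X₁) (h₂ : 𝒴 S.X₂) : 𝒴 S.X₃ := by
    have hS : E.Conf S.f S.g := ⟨S.zero, hS⟩
    have hg : Weqω E 𝒳 𝒴 S.g := weqω_of_deflationsWithKernelIn h𝒳 h𝒴 (hS.deflationsWithKernelIn h₁)
    have h₂' : Weqω E 𝒳 𝒴 (S.g ≫ (0 : S.X₃ ⟶ (0 : A))) := by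
      rw [comp_zero]
      exact weqω_of_deflationsWithKernelIn h𝒳 h𝒴 ((deflationsWithKernelIn_zero_iff h𝒴).2 h₂)
    exact (deflationsWithKernelIn_zero_iff h𝒴).1 (deflationsWithKernelIn_of_fibω_of_weqω hA h𝒴
      (fibω_zero _) ((Weqω E 𝒳 𝒴).of_precomp _ _ hg h₂'))
  exact { h with
    kernel_mem S hS h₂ h₃ := h.kernel_mem hA h𝒳 hc ⟨S.zero, hS⟩ h₂ h₃
    cokernel_mem := hc }

/-- Factor 0 → B into a trivial cofibration and a fibration: the middle object is in ω, and being a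
fibration onto B is exactly the approximation property. -/
theorem contravariantlyFinite_of_isModelStructure (hA : WeaklyIdempotentComplete A)
    (h𝒳 : IsAdditiveSummandClosed 𝒳) (h𝒴 : IsAdditiveSummandClosed 𝒴)
    (hM : IsModelStructure (CoFibω E 𝒳) (Fibω 𝒳 𝒴) (Weqω E 𝒳 𝒴)) :
    ContravariantlyFinite (𝒳 ⊓ 𝒴) := fun B => by
  have hext := ext_of_isModelStructure h𝒳 h𝒴 hM
  obtain ⟨Z, i, p, -, hi, hi', hp⟩ := hM.fac_trivial_cof (0 : (0 : A) ⟶ B)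
  obtain ⟨W, e, -, hW⟩ := (splitMonosWithCokernelIn_iff hA (h𝒳.inf h𝒴)).1
    (coFibω_inf_weqω hext hA h𝒳 h𝒴 ▸ ⟨hi, hi'⟩ : splitMonosWithCokernelIn (𝒳 ⊓ 𝒴) i)
  have h := h𝒳.inf h𝒴
  exact ⟨Z, p, h.of_iso e (h.biprod h.zero hW), fun V g hV => fibω_iff.1 hp V g hV⟩

theorem trivialObjects_weqω (hA : WeaklyIdempotentComplete A) (h𝒳 : IsAdditiveSummandClosed 𝒳)
    (h𝒴 : IsAdditiveSummandClosed 𝒴)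
    (hM : IsModelStructure (CoFibω E 𝒳) (Fibω 𝒳 𝒴) (Weqω E 𝒳 𝒴)) :
    trivialObjects (Weqω E 𝒳 𝒴) = 𝒴 := by
  have := hM.two_out_of_three
  have h₀ : Weqω E 𝒳 𝒴 (0 : (0 : A) ⟶ 0) :=
    weqω_of_deflationsWithKernelIn h𝒳 h𝒴 ((deflationsWithKernelIn_zero_iff h𝒴).2 h𝒴.zero)
  have key (Z : A) : Weqω E 𝒳 𝒴 (0 : Z ⟶ (0 : A)) ↔ 𝒴 Z :=
    ⟨fun h => (deflationsWithKernelIn_zero_iff h𝒴).1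
      (deflationsWithKernelIn_of_fibω_of_weqω hA h𝒴 (fibω_zero _) h),
      fun h => weqω_of_deflationsWithKernelIn h𝒳 h𝒴 ((deflationsWithKernelIn_zero_iff h𝒴).2 h)⟩
  ext Z
  rw [← key]
  have e : (0 : (0 : A) ⟶ Z) ≫ (0 : Z ⟶ (0 : A)) = 0 := by simp
  exact ⟨fun h => (Weqω E 𝒳 𝒴).of_precomp _ _ h (e ▸ h₀),
    fun h => (Weqω E 𝒳 𝒴).of_postcomp _ _ h (e ▸ h₀)⟩

/-! ### Cofibrant replacement and the homotopy category. -/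

namespace ExactStructure.IsCompleteCotorsionPair

theorem exists_cover (h : E.IsCompleteCotorsionPair 𝒳 𝒴) (B : A) :
    ∃ (C : A) (p : C ⟶ B), 𝒳 C ∧ E.deflationsWithKernelIn 𝒴 p := by
  obtain ⟨F, C, i, d, w, hi, hC, hF⟩ := h.cover B
  exact ⟨C, d, hC, F, i, w, hi, hF⟩

/-- Two maps from an object of `𝒳` that agree after a deflation with kernel in `𝒴` differ by a
map that factors through `𝒳 ⊓ 𝒴`. -/
theorem exists_factor (h : E.IsCompleteCotorsionPair 𝒳 𝒴) {X C B : A} (hX : 𝒳 X) {p : C ⟶ B}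
    (hp : E.deflationsWithKernelIn 𝒴 p) {f g : X ⟶ C} (hfg : f ≫ p = g ≫ p) :
    ∃ (W : A) (u : X ⟶ W) (r : W ⟶ C), (𝒳 ⊓ 𝒴) W ∧ f - g = u ≫ r := by
  obtain ⟨L, l, hl, hL⟩ := deflationsWithKernelIn_iff.1 hp
  obtain ⟨a, ha⟩ := hl.isKer.lift (f - g) (by simp [hfg])
  -- The difference lands in the kernel L, which is in `𝒴`, so it extends along X → F; the envelope
  -- F is in ω because it is also an extension of members of `𝒳`.
  obtain ⟨F, C', i, d, w, hi, hC', hF⟩ := h.envelope X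
  have hi : E.Conf i d := ⟨w, hi⟩
  obtain ⟨b, hb⟩ := (ext_of_isCotorsionPair h.toIsCotorsionPair _ _ hC' hL).exists_extension hi a
  exact ⟨F, i, b ≫ l, ⟨h.extensionClosed_left hi hX hC', hF⟩, by rw [reassoc_of% hb, ha]⟩

/-- A cofibrant replacement of `B`. -/
noncomputable def coverObj (h : E.IsCompleteCotorsionPair 𝒳 𝒴) (B : A) : 𝒳.FullSubcategory :=
  ⟨(h.exists_cover B).choose, (h.exists_cover B).choose_spec.choose_spec.1⟩

/-- The deflation from the cofibrant replacement. -/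
noncomputable def coverMap (h : E.IsCompleteCotorsionPair 𝒳 𝒴) (B : A) : (h.coverObj B).obj ⟶ B :=
  (h.exists_cover B).choose_spec.choose

theorem coverMap_mem (h : E.IsCompleteCotorsionPair 𝒳 𝒴) (B : A) :
    E.deflationsWithKernelIn 𝒴 (h.coverMap B) :=
  (h.exists_cover B).choose_spec.choose_spec.2

theorem exists_coverLift (h : E.IsCompleteCotorsionPair 𝒳 𝒴) {B B' : A} (f : B ⟶ B') :
    ∃ l : h.coverObj B ⟶ h.coverObj B', l.hom ≫ h.coverMap B' = h.coverMap B ≫ f := by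
  obtain ⟨l, hl⟩ := exists_lift_of_source_of_ext (ext_of_isCotorsionPair h.toIsCotorsionPair)
    (h.coverObj B).property (h.coverMap_mem B') (h.coverMap B ≫ f)
  exact ⟨ObjectProperty.homMk l, hl⟩

theorem quotient_map_eq (h : E.IsCompleteCotorsionPair 𝒳 𝒴) {X C : 𝒳.FullSubcategory} {B : A}
    {p : C.obj ⟶ B} (hp : E.deflationsWithKernelIn 𝒴 p) {f g : X ⟶ C}
    (hfg : f.hom ≫ p = g.hom ≫ p) :
    (Quotient.functor (factorRel 𝒳 (𝒳 ⊓ 𝒴))).map f =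
      (Quotient.functor (factorRel 𝒳 (𝒳 ⊓ 𝒴))).map g :=
  CategoryTheory.Quotient.sound _ (h.exists_factor X.property hp hfg)

/-- The cofibrant replacement functor, with values in the additive quotient. -/
noncomputable def replacement (h : E.IsCompleteCotorsionPair 𝒳 𝒴) :
    A ⥤ AdditiveQuotient 𝒳 (𝒳 ⊓ 𝒴) where
  obj B := (Quotient.functor _).obj (h.coverObj B)
  map f := (Quotient.functor _).map (h.exists_coverLift f).choose
  map_id B := by
    rw [← CategoryTheory.Functor.map_id]
    exact h.quotient_map_eq (h.coverMap_mem B)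
      ((h.exists_coverLift (𝟙 B)).choose_spec.trans (by simp))
  map_comp {B B' B''} f g := by
    rw [← CategoryTheory.Functor.map_comp]
    refine h.quotient_map_eq (h.coverMap_mem B'') ?_
    rw [(h.exists_coverLift (f ≫ g)).choose_spec, ObjectProperty.FullSubcategory.comp_hom,
      Category.assoc, (h.exists_coverLift g).choose_spec,
      reassoc_of% (h.exists_coverLift f).choose_spec]

theorem replacement_map (h : E.IsCompleteCotorsionPair 𝒳 𝒴) {B B' : A} (f : B ⟶ B') :
    ∃ l : h.coverObj B ⟶ h.coverObj B', l.hom ≫ h.coverMap B' = h.coverMap B ≫ f ∧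
      h.replacement.map f = (Quotient.functor _).map l :=
  ⟨_, (h.exists_coverLift f).choose_spec, rfl⟩

/-- A weak equivalence between objects of `𝒳` is invertible in the additive quotient. -/
theorem isIso_quotient_map (h : E.IsCompleteCotorsionPair 𝒳 𝒴) {X X' : 𝒳.FullSubcategory}
    (f : X ⟶ X') (hf : Weqω E 𝒳 𝒴 f.hom) :
    IsIso ((Quotient.functor (factorRel 𝒳 (𝒳 ⊓ 𝒴))).map f) := by
  obtain ⟨W, t, hW, hf⟩ := hf
  -- A section of (f, t) exists since X' is in `𝒳`. Its component in X inverts `f`: one composite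
  -- differs from the identity by a map through W, the other by `exists_factor`.
  obtain ⟨s, hs⟩ := exists_lift_of_source_of_ext (ext_of_isCotorsionPair h.toIsCotorsionPair)
    X'.property hf (𝟙 _)
  let g : X' ⟶ X := ObjectProperty.homMk (s ≫ biprod.fst)
  refine ⟨(Quotient.functor _).map g, ?_, ?_⟩
  · rw [← CategoryTheory.Functor.map_comp, ← CategoryTheory.Functor.map_id]
    obtain ⟨V, u, r, hV, hur⟩ := h.exists_factor X.property hf (f := f.hom ≫ s) (g := biprod.inl)
      (by simp [hs])
    refine CategoryTheory.Quotient.sound _ ⟨V, u, r ≫ biprod.fst, hV, ?_⟩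
    rw [← reassoc_of% hur]
    simp [g]
  · rw [← CategoryTheory.Functor.map_comp, ← CategoryTheory.Functor.map_id]
    refine CategoryTheory.Quotient.sound _ ⟨W, s ≫ biprod.snd, -t, hW, ?_⟩
    have : s ≫ biprod.fst ≫ f.hom + s ≫ biprod.snd ≫ t = 𝟙 X'.obj := by
      rw [← hs, biprod.desc_eq, Preadditive.comp_add]
    simp [g, ← this]

theorem replacement_inverts (h : E.IsCompleteCotorsionPair 𝒳 𝒴) (h𝒳 : IsAdditiveSummandClosed 𝒳)
    (h𝒴 : IsAdditiveSummandClosed 𝒴) [(Weqω E 𝒳 𝒴).HasTwoOutOfThreeProperty] :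
    (Weqω E 𝒳 𝒴).IsInvertedBy h.replacement := fun B B' f hf => by
  obtain ⟨l, hl, e⟩ := h.replacement_map f
  rw [e]
  have weq (B : A) := weqω_of_deflationsWithKernelIn h𝒳 h𝒴 (h.coverMap_mem B)
  exact h.isIso_quotient_map l ((Weqω E 𝒳 𝒴).of_postcomp _ _ (weq B')
    (hl ▸ (Weqω E 𝒳 𝒴).comp_mem _ _ (weq B) hf))

/-- The canonical map from the replacement is an isomorphism on `𝒳`. -/
noncomputable def ιCompReplacement (h : E.IsCompleteCotorsionPair 𝒳 𝒴)
    (h𝒳 : IsAdditiveSummandClosed 𝒳) (h𝒴 : IsAdditiveSummandClosed 𝒴) :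
    𝒳.ι ⋙ h.replacement ≅ Quotient.functor (factorRel 𝒳 (𝒳 ⊓ 𝒴)) :=
  NatIso.ofComponents (fun X =>
    let p : h.coverObj X.obj ⟶ X := ObjectProperty.homMk (h.coverMap X.obj)
    have : IsIso ((Quotient.functor (factorRel 𝒳 (𝒳 ⊓ 𝒴))).map p) := h.isIso_quotient_map p
      (weqω_of_deflationsWithKernelIn h𝒳 h𝒴 (h.coverMap_mem X.obj))
    @asIso _ _ _ _ ((Quotient.functor (factorRel 𝒳 (𝒳 ⊓ 𝒴))).map p) this) (fun {X Y} f => by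
      obtain ⟨l, hl, e⟩ := h.replacement_map f.hom
      have hl' : l ≫ ObjectProperty.homMk (h.coverMap Y.obj) =
          ObjectProperty.homMk (h.coverMap X.obj) ≫ f := by
        ext
        exact hl
      have := congrArg (Quotient.functor (factorRel 𝒳 (𝒳 ⊓ 𝒴))).map hl'
      rw [CategoryTheory.Functor.map_comp, CategoryTheory.Functor.map_comp] at this
      rw [Functor.comp_map, ObjectProperty.ι_map, e]
      exact this)

end ExactStructure.IsCompleteCotorsionPair

/-- Maps that differ by a map through `𝒳 ⊓ 𝒴` agree in the homotopy category. -/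
theorem localization_map_eq (hA : WeaklyIdempotentComplete A)
    (h𝒳 : IsAdditiveSummandClosed 𝒳) (h𝒴 : IsAdditiveSummandClosed 𝒴) {X Y W : A} {f g : X ⟶ Y}
    {u : X ⟶ W} {r : W ⟶ Y} (hW : (𝒳 ⊓ 𝒴) W) (h : f - g = u ≫ r) :
    (Weqω E 𝒳 𝒴).Q.map f = (Weqω E 𝒳 𝒴).Q.map g := by
  have : IsIso ((Weqω E 𝒳 𝒴).Q.map (biprod.inl : Y ⟶ Y ⊞ W)) :=
    (Weqω E 𝒳 𝒴).Q_inverts _ (weqω_biprod_inl hA h𝒳 h𝒴 Y hW)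
  -- Both maps are retractions of the weak equivalence Y → Y ⊕ W, so they agree once it is inverted;
  -- `f` and `g` are their composites with (g, u). The object Y ⊕ W acts as a cylinder for maps
  -- through ω.
  have e : (Weqω E 𝒳 𝒴).Q.map (biprod.desc (𝟙 Y) r) = (Weqω E 𝒳 𝒴).Q.map biprod.fst := by
    rw [← cancel_epi ((Weqω E 𝒳 𝒴).Q.map (biprod.inl : Y ⟶ Y ⊞ W)),
      ← CategoryTheory.Functor.map_comp, ← CategoryTheory.Functor.map_comp]
    simp
  have hf : f = biprod.lift g u ≫ biprod.desc (𝟙 Y) r := by simp [← h]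
  have hg : g = biprod.lift g u ≫ biprod.fst := by simp
  rw [hf, CategoryTheory.Functor.map_comp, e, ← CategoryTheory.Functor.map_comp, ← hg]

/-- The functor `𝒳/ω ⥤ Ho(A)` induced by the inclusion. -/
noncomputable def quotientToLocalization (E : ExactStructure A) (hA : WeaklyIdempotentComplete A)
    (h𝒳 : IsAdditiveSummandClosed 𝒳) (h𝒴 : IsAdditiveSummandClosed 𝒴) :
    AdditiveQuotient 𝒳 (𝒳 ⊓ 𝒴) ⥤ (Weqω E 𝒳 𝒴).Localization :=
  CategoryTheory.Quotient.lift _ (𝒳.ι ⋙ (Weqω E 𝒳 𝒴).Q) fun _ _ _ _ ⟨_, _, _, hW, e⟩ =>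
    localization_map_eq hA h𝒳 h𝒴 hW e

/-- The composite `𝒳 ⥤ 𝒳/ω ⥤ Ho(A)` is the restriction of the localization functor. -/
noncomputable def functorCompQuotientToLocalization (hA : WeaklyIdempotentComplete A)
    (h𝒳 : IsAdditiveSummandClosed 𝒳) (h𝒴 : IsAdditiveSummandClosed 𝒴) :
    Quotient.functor (factorRel 𝒳 (𝒳 ⊓ 𝒴)) ⋙ quotientToLocalization E hA h𝒳 h𝒴 ≅
      𝒳.ι ⋙ (Weqω E 𝒳 𝒴).Q :=
  CategoryTheory.Quotient.lift.isLift _ _ _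

/-- The functor `Ho(A) ⥤ 𝒳/ω` induced by the cofibrant replacement. -/
noncomputable def localizationToQuotient (h𝒳 : IsAdditiveSummandClosed 𝒳)
    (h𝒴 : IsAdditiveSummandClosed 𝒴) (h : E.IsCompleteCotorsionPair 𝒳 𝒴)
    [(Weqω E 𝒳 𝒴).HasTwoOutOfThreeProperty] :
    (Weqω E 𝒳 𝒴).Localization ⥤ AdditiveQuotient 𝒳 (𝒳 ⊓ 𝒴) :=
  Localization.lift h.replacement (h.replacement_inverts h𝒳 h𝒴) (Weqω E 𝒳 𝒴).Q

/-- The equivalence `𝒳/ω ≌ Ho(A)`. -/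
noncomputable def quotientEquivalence (hA : WeaklyIdempotentComplete A)
    (h𝒳 : IsAdditiveSummandClosed 𝒳) (h𝒴 : IsAdditiveSummandClosed 𝒴)
    (h : E.IsCompleteCotorsionPair 𝒳 𝒴) [(Weqω E 𝒳 𝒴).HasTwoOutOfThreeProperty] :
    AdditiveQuotient 𝒳 (𝒳 ⊓ 𝒴) ≌ (Weqω E 𝒳 𝒴).Localization :=
  let Q := (Weqω E 𝒳 𝒴).Q
  let Φ := quotientToLocalization E hA h𝒳 h𝒴
  let Ψ := localizationToQuotient h𝒳 h𝒴 h
  let fac : Q ⋙ Ψ ≅ h.replacement := Localization.fac _ (h.replacement_inverts h𝒳 h𝒴) Q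
  let facΦ := functorCompQuotientToLocalization (E := E) hA h𝒳 h𝒴
  let η : 𝟭 _ ≅ Φ ⋙ Ψ := Quotient.natIsoLift _
    (Functor.rightUnitor _ ≪≫ (h.ιCompReplacement h𝒳 h𝒴).symm ≪≫
      Functor.isoWhiskerLeft 𝒳.ι fac.symm ≪≫ (Functor.associator _ _ _).symm ≪≫
      Functor.isoWhiskerRight facΦ.symm Ψ ≪≫ Functor.associator _ _ _)
  -- The cover maps are weak equivalences, hence invertible in the localization, and the equation
  -- defining the lifts between covers is their naturality.
  let τ : h.replacement ⋙ Φ ≅ Q := NatIso.ofComponents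
    (fun B => Localization.isoOfHom Q (Weqω E 𝒳 𝒴) (h.coverMap B)
      (weqω_of_deflationsWithKernelIn h𝒳 h𝒴 (h.coverMap_mem B))) (fun {B B'} f => by
        obtain ⟨l, hl, e⟩ := h.replacement_map f
        have : (h.replacement ⋙ Φ).map f = Q.map l.hom := by
          rw [Functor.comp_map, e]
          rfl
        rw [this]
        change Q.map l.hom ≫ Q.map (h.coverMap B') = Q.map (h.coverMap B) ≫ Q.map f
        rw [← CategoryTheory.Functor.map_comp, hl, CategoryTheory.Functor.map_comp])
  let ε : Ψ ⋙ Φ ≅ 𝟭 _ :=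
    letI : Localization.Lifting Q (Weqω E 𝒳 𝒴) (h.replacement ⋙ Φ) (Ψ ⋙ Φ) :=
      ⟨(Functor.associator _ _ _).symm ≪≫ Functor.isoWhiskerRight fac Φ⟩
    letI : Localization.Lifting Q (Weqω E 𝒳 𝒴) Q (𝟭 _) := ⟨Functor.rightUnitor _⟩
    Localization.liftNatIso Q (Weqω E 𝒳 𝒴) (h.replacement ⋙ Φ) Q _ _ τ
  .mk Φ Ψ η ε

end OmegaModel

theorem theorem1p1 {A : Type u} [Category.{v} A] [Preadditive A] [HasZeroObject A]
    [HasBinaryBiproducts A] (E : ExactStructure A) (hA : WeaklyIdempotentComplete A)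
    (𝒳 𝒴 : ObjectProperty A)
    (h𝒳 : IsAdditiveSummandClosed 𝒳) (h𝒴 : IsAdditiveSummandClosed 𝒴) :
    (IsModelStructure (CoFibω E 𝒳) (Fibω 𝒳 𝒴) (Weqω E 𝒳 𝒴) ↔
      E.IsHereditaryCompleteCotorsionPair 𝒳 𝒴 ∧ ContravariantlyFinite (𝒳 ⊓ 𝒴)) ∧
    (IsModelStructure (CoFibω E 𝒳) (Fibω 𝒳 𝒴) (Weqω E 𝒳 𝒴) →
      CoFibω E 𝒳 ⊓ Weqω E 𝒳 𝒴 = splitMonosWithCokernelIn (𝒳 ⊓ 𝒴) ∧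
      Fibω 𝒳 𝒴 ⊓ Weqω E 𝒳 𝒴 = E.deflationsWithKernelIn 𝒴 ∧
      cofibrantObjects (CoFibω E 𝒳) = 𝒳 ∧
      fibrantObjects (Fibω 𝒳 𝒴) = ⊤ ∧
      trivialObjects (Weqω E 𝒳 𝒴) = 𝒴 ∧
      ∃ e : AdditiveQuotient 𝒳 (𝒳 ⊓ 𝒴) ≌ (Weqω E 𝒳 𝒴).Localization,
        Nonempty (Quotient.functor (factorRel 𝒳 (𝒳 ⊓ 𝒴)) ⋙ e.functor ≅ 𝒳.ι ⋙ (Weqω E 𝒳 𝒴).Q)) := by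
  refine ⟨⟨fun hM => ⟨isHereditaryCompleteCotorsionPair_of_isModelStructure hA h𝒳 h𝒴 hM,
    contravariantlyFinite_of_isModelStructure hA h𝒳 h𝒴 hM⟩,
    fun h => isModelStructure hA h𝒳 h𝒴 h.1 h.2⟩, fun hM => ?_⟩
  have hext := ext_of_isModelStructure h𝒳 h𝒴 hM
  have := hM.two_out_of_three
  refine ⟨coFibω_inf_weqω hext hA h𝒳 h𝒴, fibω_inf_weqω hext hA h𝒳 h𝒴, ?_, ?_,
    trivialObjects_weqω hA h𝒳 h𝒴 hM,
    quotientEquivalence hA h𝒳 h𝒴 (isCompleteCotorsionPair_of_isModelStructure hA h𝒳 h𝒴 hM),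
    ⟨functorCompQuotientToLocalization hA h𝒳 h𝒴⟩⟩
  · ext Z
    exact coFibω_zero_iff h𝒳
  · ext Z
    exact ⟨fun _ => trivial, fun _ => fibω_zero Z⟩
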